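/- A partition $\lambda$ (the empty one included) is identified with its Ferrers diagram, and $|\lambda|$ is its number of boxes. Let $\mathcal{SC}$ be the set of self-conjugate partitions, i.e. those equal to their conjugate. The hook-length of a box $v$ of $\lambda$ is the number of boxes $u$ of $\lambda$ such that $u=v$, or $u$ lies strictly to the right of $v$ in the same row, or $u$ lies strictly below $v$ in the same column. For a positive integer $t$, let $\mathcal{H}_t(\lambda)$ be the multiset of all hook-lengths of $\lambda$ that are divisible by $t$. The BG-rank $\mathrm{BG}(\lambda)\in\mathbb{Z}$ is the sum over the boxes of $\lambda$ of the signs $\pm1$ that alternate along rows and columns, starting with $+1$ in the top left box. For complex $a,q$ with $|q|<1$ put $(a;q)_\infty=\prod_{j\ge 0}(1-aq^j)$. **Corollary.** Let $t$ be an even positive integer, and let $q,x,b$ be complex numbers with $|q|<1$ and $b\neq 0$. Then the series on the left below converges absolutely and $$\sum_{\lambda\in\mathcal{SC}}q^{|\lambda|}x^{|\mathcal{H}_t(\lambda)|}b^{\mathrm{BG}(\lambda)}\prod_{h\in\mathcal{H}_t(\lambda)}\frac{1}{h^{1/2}}=\left(q^{2t};q^{2t}\right)_\infty^{t/2}\left(-bq;q^4\right)_\infty\left(-q^3/b;q^4\right)_\infty\exp\left(\frac{x^2q^{2t}}{2}+\frac{x^4q^{4t}}{4t}\right),$$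 where $h^{1/2}$ is the positive square root, and $0^0=1$. -/

import Mathlib

/-!
Partitions are Mathlib's Young diagrams: `YoungDiagram` is the type of all partitions (the empty
one included), `μ.card` is the size, and `μ.transpose` is the conjugate partition.
-/

namespace SelfConj

/-- A partition is self-conjugate if it equals its conjugate. -/
def IsSelfConjugate (μ : YoungDiagram) : Prop :=
  μ.transpose = μ

/-- The hook-length of the box `v = (row, column)` of `μ`: the number of boxes `u` of `μ` such that
`u = v`, or `u` lies strictly below `v` in the same column, or `u` lies strictly to the right of `v`
in the same row. -/
def hookLength (μ : YoungDiagram) (v : ℕ × ℕ) : ℕ :=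
  (μ.cells.filter fun u =>
    u = v ∨ (u.2 = v.2 ∧ v.1 < u.1) ∨ (u.1 = v.1 ∧ v.2 < u.2)).card

/-- The multiset of all hook-lengths of `μ`. -/
def hooks (μ : YoungDiagram) : Multiset ℕ :=
  μ.cells.val.map (hookLength μ)

/-- The multiset of all hook-lengths of `μ` that are divisible by `t`. -/
def hooksMod (t : ℕ) (μ : YoungDiagram) : Multiset ℕ :=
  (hooks μ).filter fun h => t ∣ h

/-- The BG-rank: fill the boxes with alternating signs along rows and columns, starting with `+1` in
the corner box (here the box `(0, 0)`), and sum over all boxes. -/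
def bgRank (μ : YoungDiagram) : ℤ :=
  ∑ c ∈ μ.cells, (-1 : ℤ) ^ (c.1 + c.2)

/-- The infinite `q`-Pochhammer symbol `(a; q)_∞ = ∏_{j ≥ 0} (1 - a q ^ j)`, for `‖q‖ < 1`. -/
noncomputable def qPochhammerInf (a q : ℂ) : ℂ :=
  ∏' j : ℕ, (1 - a * q ^ j)

/-- The product defining `qPochhammerInf a q` converges when `‖q‖ < 1`. -/
theorem multipliable_qPochhammerInf (a : ℂ) {q : ℂ} (hq : ‖q‖ < 1) :
    Multipliable fun j : ℕ => 1 - a * q ^ j := by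
  have h : Summable fun j : ℕ => ‖-(a * q ^ j)‖ := by
    simpa [norm_mul, norm_pow] using
      (summable_geometric_of_lt_one (norm_nonneg q) hq).mul_left ‖a‖
  simpa [sub_eq_add_neg] using multipliable_one_add_of_summable h

end SelfConj

/-! Put `t = 2 * u`. A self-conjugate partition is determined by the finite set `A` of its diagonal
arm lengths. The diagonal hook of arm `a` has `2 * a + 1` boxes and signed sum `(-1) ^ a`, so the
factor in `q` and `b` is the product of `armWeight` over `A`. The edge sequence of the partition is
the Maya diagram `mayaSet (A, A)`, in which the reflection `n ↦ -1 - n` exchanges particles and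
holes. Hooks are the pairs (particle, lower hole), and their lengths are the distances.

A hook-length is divisible by `2 * u` exactly when its two sites lie in one residue class. The
reflection swaps the classes `r` and `2 * u - 1 - r` and fixes none, so `A` amounts to `u` arbitrary
independent Maya diagrams, each of whose hooks occurs twice in the partition
(`finprod_invPairs_joinSites`). This doubling turns the square root of `h` into `h`. A Maya diagram
is an integer charge together with a partition (`mayaEquiv`), and the size is additive in the two
(`energy_eq`). Hence the series factors (`hasSum_armsWeight`) into `u` sums over charges and the
`u`-th power of the sum of `y ^ |L| / ∏ h` over all partitions `L`, where `y = q ^ (4u) * x ^ 2 /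
(2u)`.

That last sum is `exp (y + y ^ 2 / 2)` (`tsum_hookWeight`). The sums `hookSum n` satisfy `(n + 2) H
(n + 2) = H (n + 1) + H n`, because reciprocal hook products obey branching rules for removing and
for adding a box, and every partition has one more addable than removable box. The branching rules
are residue identities for `∏ (x - j + ε) / (x - j)`.

The charge sums are not computed individually. Giving every hook weight `1`, the same factorization
says that `∏ (1 + armWeight a)` is the product of the charge sums times the `u`-th power of the
partition generating function, which is the reciprocal of `qPochhammerInf`. This yields their
product (`prod_tsum_chargeWeight`). -/

namespace SelfConj

open Finset

/-! ### Partial fractions of a shifted product -/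

section Interpolation

variable {K : Type*} [Field K] [DecidableEq K]

/-- The residues of `∏ (x - j + ε) / (x - j)`, divided by `ε`. -/
def shiftResidue (ε : K) (s : Finset K) (i : K) : K :=
  ∏ j ∈ s.erase i, (i - j + ε) / (i - j)

theorem shiftResidue_insert_of_mem {ε k i : K} {s : Finset K} (hk : k ∉ s) (hi : i ∈ s) :
    shiftResidue ε (insert k s) i = (1 + ε / (i - k)) * shiftResidue ε s i := by
  have hne : k ≠ i := fun h => hk (h ▸ hi)
  have hsub : i - k ≠ 0 := sub_ne_zero.2 hne.symm
  unfold shiftResidue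
  rw [erase_insert_of_ne hne, prod_insert (fun h => hk (mem_of_mem_erase h)), add_div,
    div_self hsub]

theorem shiftResidue_insert_self {ε k : K} {s : Finset K} (hk : k ∉ s) :
    shiftResidue ε (insert k s) k = ∏ j ∈ s, (k - j + ε) / (k - j) := by
  unfold shiftResidue
  rw [erase_insert hk]

/-- Partial fraction expansion of a function with simple poles on `s` and value `1` at infinity, by
adding one pole at a time. -/
theorem prod_shift_div_eq (ε : K) (s : Finset K) :
    ∀ x, x ∉ s → ∏ j ∈ s, (x - j + ε) / (x - j)
      = 1 + ε * ∑ i ∈ s, shiftResidue ε s i / (x - i) := by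
  induction s using Finset.induction_on with
  | empty => simp
  | insert k s hk ih =>
    intro x hx
    have hxk : x - k ≠ 0 := sub_ne_zero.2 fun h => hx (by simp [h])
    have hxs : x ∉ s := fun h => hx (mem_insert_of_mem h)
    rw [prod_insert hk, sum_insert hk, shiftResidue_insert_self hk, ih x hxs, ih k hk]
    -- Each term uses `1 / ((x - i) * (i - k)) = (1 / (x - i) + 1 / (i - k)) / (x - k)`.
    have key : ∑ i ∈ s, shiftResidue ε (insert k s) i / (x - i)
        = ∑ i ∈ s, shiftResidue ε s i / (x - i)
          + ε / (x - k) * ∑ i ∈ s, shiftResidue ε s i / (x - i)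
          - ε / (x - k) * ∑ i ∈ s, shiftResidue ε s i / (k - i) := by
      rw [mul_sum, mul_sum, ← sum_add_distrib, ← sum_sub_distrib]
      refine sum_congr rfl fun i hi => ?_
      have h1 : x - i ≠ 0 := sub_ne_zero.2 fun h => hxs (h ▸ hi)
      have h2 : i - k ≠ 0 := sub_ne_zero.2 fun h => hk (h ▸ hi)
      have h3 : k - i ≠ 0 := sub_ne_zero.2 fun h => hk (h ▸ hi)
      have h4 : k - i = -(i - k) := by ring
      rw [shiftResidue_insert_of_mem hk hi, h4]
      field_simp
      ring
    rw [key]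
    field_simp
    ring

/-- This compares the coefficients of `1 / x` at infinity in `prod_shift_div_eq`; the induction
evaluates that expansion at the new pole. -/
theorem sum_shiftResidue (ε : K) (s : Finset K) :
    ∑ i ∈ s, shiftResidue ε s i = s.card := by
  induction s using Finset.induction_on with
  | empty => simp
  | insert k s hk ih =>
    rw [sum_insert hk, shiftResidue_insert_self hk, prod_shift_div_eq ε s k hk,
      card_insert_of_notMem hk]
    have key : ∑ i ∈ s, shiftResidue ε (insert k s) i
        = ∑ i ∈ s, shiftResidue ε s i - ε * ∑ i ∈ s, shiftResidue ε s i / (k - i) := by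
      rw [mul_sum, ← sum_sub_distrib]
      refine sum_congr rfl fun i hi => ?_
      have h2 : i - k ≠ 0 := sub_ne_zero.2 fun h => hk (h ▸ hi)
      have h4 : k - i = -(i - k) := by ring
      rw [shiftResidue_insert_of_mem hk hi, h4]
      field_simp
      ring
    rw [key, ih]
    push_cast
    ring

/-- The same comparison for the coefficients of `1 / x ^ 2`. -/
theorem sum_mul_shiftResidue (ε : K) (s : Finset K) :
    ∑ i ∈ s, i * shiftResidue ε s i = ∑ i ∈ s, i + ε * (s.card.choose 2 : ℕ) := by
  induction s using Finset.induction_on with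
  | empty => simp
  | insert k s hk ih =>
    rw [sum_insert hk, shiftResidue_insert_self hk, prod_shift_div_eq ε s k hk,
      card_insert_of_notMem hk,
      sum_insert hk]
    have key : ∑ i ∈ s, i * shiftResidue ε (insert k s) i
        = ∑ i ∈ s, i * shiftResidue ε s i + ε * ∑ i ∈ s, shiftResidue ε s i
          - ε * (k * ∑ i ∈ s, shiftResidue ε s i / (k - i)) := by
      rw [mul_sum, mul_sum, mul_sum, ← sum_add_distrib, ← sum_sub_distrib]
      refine sum_congr rfl fun i hi => ?_
      have h2 : i - k ≠ 0 := sub_ne_zero.2 fun h => hk (h ▸ hi)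
      have h4 : k - i = -(i - k) := by ring
      rw [shiftResidue_insert_of_mem hk hi, h4]
      field_simp
      ring
    rw [key, ih, sum_shiftResidue, Nat.choose_succ_succ' s.card 1]
    push_cast
    rw [Nat.choose_one_right]
    ring

end Interpolation

/-! ### Finite sets of natural numbers as beta-sets of partitions -/

/-- The size of the partition with beta-set `L`. -/
def gapCount (L : Finset ℕ) : ℕ := ∑ l ∈ L, (range l \ L).card

/-- The product of `g` over the hook-lengths of the partition with beta-set `L`. -/
def hookProd {R : Type*} [CommMonoid R] (g : ℕ → R) (L : Finset ℕ) : R :=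
  ∏ l ∈ L, ∏ j ∈ range l \ L, g (l - j)

/-- The reciprocal of the product of all hook-lengths. -/
noncomputable def hookWeight (L : Finset ℕ) : ℝ := hookProd (fun k => (k : ℝ)⁻¹) L

/-- The Vandermonde product. -/
noncomputable def vander (L : Finset ℕ) : ℝ := ∏ l ∈ L, ∏ j ∈ L with j < l, ((l : ℝ) - j)

/-- Each `j ∈ R` contributes one new factor, in the row of `i` if `j < i` and in the row of `j`
otherwise; the absolute value covers both cases. -/
theorem vander_insert {i : ℕ} {R : Finset ℕ} (hi : i ∉ R) :
    vander (insert i R) = vander R * ∏ j ∈ R, |(i : ℝ) - j| := by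
  unfold vander
  rw [prod_insert hi, filter_insert, if_neg (lt_irrefl i)]
  have h1 : ∀ l ∈ R, ∏ j ∈ insert i R with j < l, ((l : ℝ) - j)
      = (∏ j ∈ R with j < l, ((l : ℝ) - j)) * (if i < l then (l : ℝ) - i else 1) := by
    intro l hl
    rw [filter_insert]
    split_ifs with h
    · rw [prod_insert (by simp [hi]), mul_comm]
    · simp
  rw [prod_congr rfl h1, prod_mul_distrib, mul_left_comm, prod_filter, ← prod_mul_distrib]
  congr 1
  refine prod_congr rfl fun j hj => ?_
  have hne : j ≠ i := fun h => hi (h ▸ hj)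
  rcases lt_or_gt_of_ne hne with h | h
  · have : (j : ℝ) < i := by exact_mod_cast h
    rw [if_pos h, if_neg (by omega), abs_of_pos (by linarith), mul_one]
  · have : (i : ℝ) < j := by exact_mod_cast h
    rw [if_neg (by omega), if_pos h, abs_of_neg (by linarith), one_mul]
    ring

/-- Frobenius' form of the hook formula: in `l! = ∏ (l - j)` over `j < l`, the gaps `j ∉ L` cancel
the hooks and the `j ∈ L` form the Vandermonde product. -/
theorem hookWeight_mul_prod_factorial (L : Finset ℕ) :
    hookWeight L * ∏ l ∈ L, (l.factorial : ℝ) = vander L := by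
  unfold hookWeight hookProd vander
  rw [← prod_mul_distrib]
  refine prod_congr rfl fun l _ => ?_
  have h1 : (l.factorial : ℝ) = ∏ j ∈ range l, ((l : ℝ) - j) := by
    rw [← prod_range_add_one_eq_factorial, ← prod_range_reflect]
    push_cast
    refine prod_congr rfl fun j hj => ?_
    have := mem_range.1 hj
    rw [Nat.cast_sub (by omega), Nat.cast_sub (by omega)]
    push_cast; ring
  have h2 : (range l).filter (· ∈ L) = L.filter (· < l) := by
    ext j; simp [and_comm]
  rw [h1, ← prod_filter_mul_prod_filter_not (range l) (· ∈ L) (fun j : ℕ => (l : ℝ) - j), h2,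
    mul_left_comm, sdiff_eq_filter, ← prod_mul_distrib]
  rw [prod_eq_one (s := (range l).filter (· ∉ L)), mul_one]
  intro j hj
  have hj := mem_range.1 (mem_filter.1 hj).1
  have : (j : ℝ) < l := by exact_mod_cast hj
  simp only [Nat.cast_sub hj.le]
  exact inv_mul_cancel₀ (by linarith)

theorem hookWeight_nonneg (L : Finset ℕ) : 0 ≤ hookWeight L :=
  prod_nonneg fun _ _ => prod_nonneg fun _ _ => by positivity

/-- Effect of moving one bead up. No bead of `R` lies at `k` or `k + 1`, so each difference keeps
its sign and the absolute values disappear from the ratio. -/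
theorem hookWeight_insert_succ {k : ℕ} {R : Finset ℕ} (h0 : k ∉ R) (h1 : k + 1 ∉ R) :
    hookWeight (insert (k + 1) R)
      = hookWeight (insert k R) * (((k : ℝ) + 1)⁻¹ * ∏ j ∈ R, ((k : ℝ) - j + 1) / (k - j)) := by
  have e0 := hookWeight_mul_prod_factorial (insert k R)
  have e1 := hookWeight_mul_prod_factorial (insert (k + 1) R)
  rw [prod_insert h0, vander_insert h0] at e0
  rw [prod_insert h1, vander_insert h1] at e1
  have hF : (∏ l ∈ R, (l.factorial : ℝ)) ≠ 0 := prod_ne_zero_iff.2 fun l _ => by positivity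
  have hk : (k.factorial : ℝ) ≠ 0 := by positivity
  have habs : ∏ j ∈ R, |((k + 1 : ℕ) : ℝ) - j|
      = (∏ j ∈ R, |(k : ℝ) - j|) * ∏ j ∈ R, ((k : ℝ) - j + 1) / (k - j) := by
    rw [← prod_mul_distrib]
    refine prod_congr rfl fun j hj => ?_
    have hne : j ≠ k := fun h => h0 (h ▸ hj)
    have hne' : j ≠ k + 1 := fun h => h1 (h ▸ hj)
    push_cast
    rcases lt_or_gt_of_ne hne with h | h
    · have : (j : ℝ) < k := by exact_mod_cast h
      rw [abs_of_pos (by linarith), abs_of_pos (by linarith), mul_div_cancel₀ _ (by linarith)]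
      ring
    · have : (k : ℝ) + 1 < j := by exact_mod_cast (show k + 1 < j by omega)
      rw [abs_of_neg (by linarith), abs_of_neg (by linarith), neg_mul,
        mul_div_cancel₀ _ (by linarith)]
      ring
  rw [habs, ← mul_assoc (vander R), ← e0, Nat.factorial_succ] at e1
  push_cast at e1
  have hk1 : (k : ℝ) + 1 ≠ 0 := by positivity
  have h2 : hookWeight (insert (k + 1) R) * (((k : ℝ) + 1) * (k.factorial * ∏ l ∈ R, (l.factorial : ℝ)))
    = hookWeight (insert k R) * (((k : ℝ) + 1)⁻¹ * ∏ j ∈ R, ((k : ℝ) - j + 1) / (k - j))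
      * (((k : ℝ) + 1) * (k.factorial * ∏ l ∈ R, (l.factorial : ℝ))) := by
    rw [← mul_assoc, ← mul_assoc] at e1 ⊢
    rw [e1]
    field_simp
  exact mul_right_cancel₀ (by positivity) h2

end SelfConj

namespace SelfConj

open Finset

/-- The bead `l` has `l` sites below it, either gaps or beads; the beads below beads count the pairs
in `L`. -/
theorem gapCount_add_choose (L : Finset ℕ) : gapCount L + L.card.choose 2 = ∑ l ∈ L, l := by
  induction L using Finset.induction_on_max with
  | empty => simp [gapCount]
  | insert a s hs ih =>
    have ha : a ∉ s := fun h => lt_irrefl _ (hs a h)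
    have hsub : s ⊆ range a := fun x hx => mem_range.2 (hs x hx)
    have h1 : range a \ insert a s = range a \ s := by
      ext x; simp only [mem_sdiff, mem_range, mem_insert]; grind
    have h2 : ∑ l ∈ s, (range l \ insert a s).card = ∑ l ∈ s, (range l \ s).card := by
      refine sum_congr rfl fun l hl => ?_
      have := hs l hl
      congr 1
      ext x; simp only [mem_sdiff, mem_range, mem_insert]; grind
    have h3 : s.card ≤ a := by simpa using card_le_card hsub
    unfold gapCount at ih ⊢
    rw [sum_insert ha, sum_insert ha, h1, h2, card_sdiff_of_subset hsub, card_range,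
      card_insert_of_notMem ha, Nat.choose_succ_succ' s.card 1, Nat.choose_one_right]
    norm_num only at ih ⊢
    omega

theorem lt_card_add_gapCount {L : Finset ℕ} {l : ℕ} (hl : l ∈ L) : l < L.card + gapCount L := by
  have h1 : (range l \ L).card ≤ gapCount L :=
    single_le_sum (f := fun l => (range l \ L).card) (fun _ _ => Nat.zero_le _) hl
  have h2 : (range l).card ≤ (range l \ L).card + (L.erase l).card := by
    refine (card_le_card ?_).trans (card_union_le _ _)
    intro x hx
    simp only [mem_range, mem_union, mem_sdiff, mem_erase] at hx ⊢
    by_cases h : x ∈ L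
    · exact Or.inr ⟨by omega, h⟩
    · exact Or.inl ⟨hx, h⟩
  have h3 := card_erase_add_one hl
  rw [card_range] at h2
  omega

/-! ### Bead moves and the branching rules -/

/-- The beads that can move one step up. -/
def ups (L : Finset ℕ) : Finset ℕ := {k ∈ L | k + 1 ∉ L}

/-- The beads that can move one step down. -/
def downs (L : Finset ℕ) : Finset ℕ := {i ∈ L | 0 < i ∧ i - 1 ∉ L}

/-- The map `k ↦ k + 1` matches beads blocked above with nonzero beads blocked below; the bead `0`
makes the difference. -/
theorem card_ups {L : Finset ℕ} (h0 : 0 ∈ L) : (ups L).card = (downs L).card + 1 := by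
  have h1 : (ups L).card + {k ∈ L | k + 1 ∈ L}.card = L.card := by
    rw [add_comm]; exact card_filter_add_card_filter_not _
  have h2 : downs L ∪ {i ∈ L | 0 < i ∧ i - 1 ∈ L} = L.erase 0 := by
    ext i; simp only [downs, mem_union, mem_filter, mem_erase]; grind
  have h3 : Disjoint (downs L) {i ∈ L | 0 < i ∧ i - 1 ∈ L} := by
    rw [disjoint_left]; intro i; simp only [downs, mem_filter]; grind
  have h4 : {k ∈ L | k + 1 ∈ L}.card = {i ∈ L | 0 < i ∧ i - 1 ∈ L}.card := by
    refine card_bij' (fun k _ => k + 1) (fun i _ => i - 1) ?_ ?_ ?_ ?_ <;>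
      intro i hi <;> simp only [mem_filter] at hi ⊢ <;> grind
  have h5 := card_erase_add_one h0
  rw [← h2, card_union_of_disjoint h3] at h5
  omega

theorem shiftResidue_map_cast (ε : ℝ) (L : Finset ℕ) (i : ℕ) :
    shiftResidue ε (L.map Nat.castEmbedding) (i : ℝ)
      = ∏ j ∈ L.erase i, ((i : ℝ) - j + ε) / (i - j) := by
  have : (L.map Nat.castEmbedding).erase (i : ℝ) = (L.erase i).map Nat.castEmbedding :=
    (map_erase Nat.castEmbedding L i).symm
  rw [shiftResidue, this, prod_map]
  rfl

/-- Each ratio of weights is `i` times a residue for `ε = -1`, so `sum_mul_shiftResidue` gives `∑ l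
- choose`, which is the size. -/
theorem sum_hookWeight_down (L : Finset ℕ) :
    ∑ i ∈ downs L, hookWeight (insert (i - 1) (L.erase i)) = gapCount L * hookWeight L := by
  have h1 : ∀ i ∈ downs L, hookWeight (insert (i - 1) (L.erase i))
      = hookWeight L * (i * shiftResidue (-1) (L.map Nat.castEmbedding) (i : ℝ)) := by
    intro i hi
    obtain ⟨hiL, hpos, hi1⟩ := mem_filter.1 hi
    obtain ⟨k, rfl⟩ : ∃ k, i = k + 1 := ⟨i - 1, by omega⟩
    simp only [Nat.add_sub_cancel] at hi1 ⊢
    have hk : k ∉ L.erase (k + 1) := fun h => hi1 (mem_of_mem_erase h)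
    have := hookWeight_insert_succ hk (notMem_erase (k + 1) L)
    rw [insert_erase hiL] at this
    rw [this, shiftResidue_map_cast]
    -- Shifting `k` up and shifting `k + 1` down give factorwise inverse products.
    have h2 : (∏ j ∈ L.erase (k + 1), ((k : ℝ) - j + 1) / (k - j))
        * ∏ j ∈ L.erase (k + 1), (((k + 1 : ℕ) : ℝ) - j + -1) / ((k + 1 : ℕ) - j) = 1 := by
      rw [← prod_mul_distrib]
      refine prod_eq_one fun j hj => ?_
      have a1 : (k : ℝ) - j ≠ 0 := sub_ne_zero.2 (by
        intro h; exact hk ((Nat.cast_injective h : k = j) ▸ hj))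
      have a2 : (k : ℝ) + 1 - j ≠ 0 := sub_ne_zero.2 (by
        intro h; exact (mem_erase.1 hj).1 (by exact_mod_cast h.symm))
      have a3 : (k : ℝ) - j + 1 ≠ 0 := by convert a2 using 1; ring
      push_cast
      field_simp
      ring
    have hk1 : ((k : ℝ) + 1) ≠ 0 := by positivity
    have hinv := inv_mul_cancel₀ hk1
    push_cast at h2 ⊢
    generalize (∏ j ∈ L.erase (k + 1), ((k : ℝ) - j + 1) / (k - j)) = P at *
    generalize (∏ j ∈ L.erase (k + 1), ((k : ℝ) + 1 - j + -1) / (k + 1 - j)) = Q at *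
    generalize hookWeight (insert k (L.erase (k + 1))) = W at *
    linear_combination (-W * P * Q) * hinv - W * h2
  rw [sum_congr rfl h1, ← mul_sum]
  -- Immovable beads contribute zero: either `i = 0`, or the factor at `j = i - 1` vanishes.
  have h2 : ∑ i ∈ downs L, (i : ℝ) * shiftResidue (-1) (L.map Nat.castEmbedding) (i : ℝ)
      = ∑ i ∈ L, (i : ℝ) * shiftResidue (-1) (L.map Nat.castEmbedding) (i : ℝ) := by
    refine sum_subset (filter_subset _ _) fun i hi hid => ?_
    rcases Nat.eq_zero_or_pos i with rfl | hpos
    · simp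
    · have hi1 : i - 1 ∈ L := by
        by_contra h; exact hid (mem_filter.2 ⟨hi, hpos, h⟩)
      rw [shiftResidue_map_cast, prod_eq_zero (i := i - 1) (mem_erase.2 ⟨by omega, hi1⟩), mul_zero]
      rw [Nat.cast_sub hpos]; simp
  have h3 := sum_mul_shiftResidue (-1) (L.map (Nat.castEmbedding (R := ℝ)))
  simp only [sum_map, Nat.castEmbedding_apply, card_map] at h3
  rw [h2, h3, mul_comm]
  have h4 : ((gapCount L + L.card.choose 2 : ℕ) : ℝ) = ∑ l ∈ L, (l : ℝ) := by
    rw [gapCount_add_choose]; push_cast; rfl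
  rw [← h4]
  push_cast
  ring

/-- The ratios are residues for `ε = 1` divided by `k + 1`. In the partial fraction expansion at `x
= -1` the bead `0` makes the product vanish, so these ratios sum to `1`. -/
theorem sum_hookWeight_up {L : Finset ℕ} (h0 : 0 ∈ L) :
    ∑ k ∈ ups L, hookWeight (insert (k + 1) (L.erase k)) = hookWeight L := by
  have h1 : ∀ k ∈ ups L, hookWeight (insert (k + 1) (L.erase k))
      = hookWeight L * (((k : ℝ) + 1)⁻¹ * shiftResidue 1 (L.map Nat.castEmbedding) (k : ℝ)) := by
    intro k hk
    obtain ⟨hkL, hk1⟩ := mem_filter.1 hk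
    rw [hookWeight_insert_succ (notMem_erase k L) fun h => hk1 (mem_of_mem_erase h),
      insert_erase hkL, shiftResidue_map_cast]
  rw [sum_congr rfl h1, ← mul_sum]
  have h2 : ∑ k ∈ ups L, ((k : ℝ) + 1)⁻¹ * shiftResidue 1 (L.map Nat.castEmbedding) (k : ℝ)
      = ∑ k ∈ L, ((k : ℝ) + 1)⁻¹ * shiftResidue 1 (L.map Nat.castEmbedding) (k : ℝ) := by
    refine sum_subset (filter_subset _ _) fun k hk hku => ?_
    have hk1 : k + 1 ∈ L := by
      by_contra h; exact hku (mem_filter.2 ⟨hk, h⟩)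
    rw [shiftResidue_map_cast, prod_eq_zero (i := k + 1) (mem_erase.2 ⟨by omega, hk1⟩), mul_zero]
    push_cast; simp
  have hnot : (-1 : ℝ) ∉ L.map (Nat.castEmbedding (R := ℝ)) := by
    simp only [mem_map, Nat.castEmbedding_apply, not_exists, not_and]
    intro j _ h
    have : (0 : ℝ) ≤ j := by positivity
    linarith
  have h3 := prod_shift_div_eq 1 (L.map (Nat.castEmbedding (R := ℝ))) (-1) hnot
  simp only [sum_map, prod_map, Nat.castEmbedding_apply] at h3
  rw [prod_eq_zero h0 (by simp)] at h3
  have h4 : ∑ k ∈ L, ((k : ℝ) + 1)⁻¹ * shiftResidue 1 (L.map Nat.castEmbedding) (k : ℝ)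
      = -∑ k ∈ L, shiftResidue 1 (L.map Nat.castEmbedding) (k : ℝ) / (-1 - k) := by
    rw [← sum_neg_distrib]
    refine sum_congr rfl fun k _ => ?_
    rw [show (-1 - (k : ℝ)) = -(k + 1) by ring]
    field_simp
  rw [h2, h4]
  linear_combination (hookWeight L) * h3

/-- The beta-sets with `m` elements of the partitions of `n`. -/
def betaSets (m n : ℕ) : Finset (Finset ℕ) :=
  {L ∈ powersetCard m (range (m + n)) | gapCount L = n}

theorem mem_betaSets {m n : ℕ} {L : Finset ℕ} :
    L ∈ betaSets m n ↔ L.card = m ∧ gapCount L = n := by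
  simp only [betaSets, mem_filter, mem_powersetCard]
  refine ⟨fun h => ⟨h.1.2, h.2⟩, ?_⟩
  rintro ⟨rfl, rfl⟩
  exact ⟨⟨fun l hl => mem_range.2 (lt_card_add_gapCount hl), rfl⟩, rfl⟩

/-- If `0` were a gap, each of the `m` beads would have a gap below it, forcing `m ≤ n`. -/
theorem zero_mem_of_mem_betaSets {m n : ℕ} (h : n < m) {L : Finset ℕ} (hL : L ∈ betaSets m n) :
    0 ∈ L := by
  by_contra h0
  obtain ⟨rfl, rfl⟩ := mem_betaSets.1 hL
  refine absurd h (not_lt.2 ?_)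
  rw [card_eq_sum_ones]
  refine sum_le_sum fun l hl => card_pos.2 ⟨0, ?_⟩
  simp only [mem_sdiff, mem_range, h0, not_false_eq_true, and_true]
  exact Nat.pos_of_ne_zero fun h => h0 (h ▸ hl)

theorem gapCount_move {k : ℕ} {R : Finset ℕ} (h0 : k ∉ R) (h1 : k + 1 ∉ R) :
    gapCount (insert (k + 1) R) = gapCount (insert k R) + 1 := by
  have e0 := gapCount_add_choose (insert k R)
  have e1 := gapCount_add_choose (insert (k + 1) R)
  rw [card_insert_of_notMem h0, sum_insert h0] at e0
  rw [card_insert_of_notMem h1, sum_insert h1] at e1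
  omega

/-- Double counting of the covering relations of Young's lattice between sizes `n` and `n + 1`. -/
theorem sum_downs_eq_sum_ups (m n : ℕ) (F : Finset ℕ → Finset ℕ → ℝ) :
    ∑ L ∈ betaSets m (n + 1), ∑ i ∈ downs L, F L (insert (i - 1) (L.erase i))
      = ∑ L ∈ betaSets m n, ∑ k ∈ ups L, F (insert (k + 1) (L.erase k)) L := by
  rw [sum_sigma', sum_sigma']
  have key1 : ∀ L i, i ∈ downs L → ∃ k R, i = k + 1 ∧ L = insert (k + 1) R ∧ k ∉ R ∧ k + 1 ∉ R := by
    intro L i hi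
    obtain ⟨hiL, hpos, hi1⟩ := mem_filter.1 hi
    refine ⟨i - 1, L.erase i, by omega, ?_, fun h => hi1 (mem_of_mem_erase h), ?_⟩
    · rw [Nat.sub_add_cancel hpos, insert_erase hiL]
    · rw [Nat.sub_add_cancel hpos]; exact notMem_erase _ _
  have key2 : ∀ L k, k ∈ ups L → ∃ R, L = insert k R ∧ k ∉ R ∧ k + 1 ∉ R := by
    intro L k hk
    obtain ⟨hkL, hk1⟩ := mem_filter.1 hk
    exact ⟨L.erase k, (insert_erase hkL).symm, notMem_erase _ _, fun h => hk1 (mem_of_mem_erase h)⟩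
  refine sum_bij' (fun p _ => ⟨insert (p.2 - 1) (p.1.erase p.2), p.2 - 1⟩)
    (fun p _ => ⟨insert (p.2 + 1) (p.1.erase p.2), p.2 + 1⟩) ?_ ?_ ?_ ?_ ?_
  · rintro ⟨L, i⟩ h
    obtain ⟨hL, hi⟩ := mem_sigma.1 h
    obtain ⟨k, R, rfl, rfl, h0, h1⟩ := key1 L i hi
    have := mem_betaSets.1 hL
    dsimp only at this
    rw [gapCount_move h0 h1, card_insert_of_notMem h1] at this
    simp only [Nat.add_sub_cancel, erase_insert h1, mem_sigma, mem_betaSets,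
      card_insert_of_notMem h0, ups, mem_filter, mem_insert_self, true_and]
    refine ⟨⟨this.1, Nat.succ_injective this.2⟩, ?_⟩
    simp [h1]
  · rintro ⟨L, k⟩ h
    obtain ⟨hL, hk⟩ := mem_sigma.1 h
    obtain ⟨R, rfl, h0, h1⟩ := key2 L k hk
    have := mem_betaSets.1 hL
    dsimp only at this
    rw [card_insert_of_notMem h0] at this
    simp only [erase_insert h0, mem_sigma, mem_betaSets, gapCount_move h0 h1,
      card_insert_of_notMem h1, downs, mem_filter, mem_insert_self, true_and]
    refine ⟨⟨this.1, by rw [this.2]⟩, by omega, ?_⟩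
    simp [h0]
  · rintro ⟨L, i⟩ h
    obtain ⟨k, R, rfl, rfl, h0, h1⟩ := key1 L i (mem_sigma.1 h).2
    simp [erase_insert h1, erase_insert h0]
  · rintro ⟨L, k⟩ h
    obtain ⟨R, rfl, h0, h1⟩ := key2 L k (mem_sigma.1 h).2
    simp [erase_insert h1, erase_insert h0]
  · rintro ⟨L, i⟩ h
    obtain ⟨k, R, rfl, rfl, h0, h1⟩ := key1 L i (mem_sigma.1 h).2
    simp [erase_insert h1, erase_insert h0]

/-- Apply the down rule in size `n + 2`, count moves from size `n + 1` by `card_ups`, and return to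
size `n` by the up rule. The bound on `m` guarantees a bead at `0`, that is, an empty row available
for a new box. -/
theorem sum_hookWeight_betaSets_succ {m n : ℕ} (h : n + 1 < m) :
    ((n : ℝ) + 2) * ∑ L ∈ betaSets m (n + 2), hookWeight L
      = ∑ L ∈ betaSets m (n + 1), hookWeight L + ∑ L ∈ betaSets m n, hookWeight L := by
  have h1 : ((n : ℝ) + 2) * ∑ L ∈ betaSets m (n + 2), hookWeight L
      = ∑ L ∈ betaSets m (n + 1 + 1), ∑ i ∈ downs L, hookWeight (insert (i - 1) (L.erase i)) := by
    rw [mul_sum]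
    refine sum_congr rfl fun L hL => ?_
    rw [sum_hookWeight_down, (mem_betaSets.1 hL).2]
    push_cast; ring
  rw [h1, sum_downs_eq_sum_ups m (n + 1) fun _ L' => hookWeight L']
  have h2 : ∑ L ∈ betaSets m (n + 1), ∑ _k ∈ ups L, hookWeight L
      = ∑ L ∈ betaSets m (n + 1), hookWeight L
        + ∑ L ∈ betaSets m (n + 1), ∑ _i ∈ downs L, hookWeight L := by
    rw [← sum_add_distrib]
    refine sum_congr rfl fun L hL => ?_
    rw [sum_const, sum_const, card_ups (zero_mem_of_mem_betaSets h hL), add_smul, one_smul, add_comm]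
  rw [h2, sum_downs_eq_sum_ups m n fun L _ => hookWeight L]
  congr 1
  exact sum_congr rfl fun L hL => sum_hookWeight_up (zero_mem_of_mem_betaSets (by omega) hL)

theorem sum_hookWeight_betaSets_one {m : ℕ} (h : 0 < m) :
    ∑ L ∈ betaSets m 1, hookWeight L = ∑ L ∈ betaSets m 0, hookWeight L := by
  have h1 : ∑ L ∈ betaSets m 1, hookWeight L
      = ∑ L ∈ betaSets m (0 + 1), ∑ i ∈ downs L, hookWeight (insert (i - 1) (L.erase i)) := by
    refine sum_congr rfl fun L hL => ?_
    rw [sum_hookWeight_down, (mem_betaSets.1 hL).2]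
    simp
  rw [h1, sum_downs_eq_sum_ups m 0 fun _ L' => hookWeight L']
  refine sum_congr rfl fun L hL => ?_
  have hd : downs L = ∅ := by
    rw [eq_empty_iff_forall_notMem]
    intro i hi
    obtain ⟨hiL, hpos, hi1⟩ := mem_filter.1 hi
    have h0 := (mem_betaSets.1 hL).2
    rw [gapCount, sum_eq_zero_iff] at h0
    have := h0 i hiL
    rw [card_eq_zero, sdiff_eq_empty_iff_subset] at this
    exact hi1 (this (mem_range.2 (by omega)))
  rw [sum_const, card_ups (zero_mem_of_mem_betaSets h hL), hd]
  simp

end SelfConj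

namespace SelfConj

open Finset Filter Topology

/-! ### Normalized beta-sets and the sums of reciprocal hook products -/

/-- Shift a set of natural numbers by one. -/
def succSet (L : Finset ℕ) : Finset ℕ := L.map (addRightEmbedding 1)

/-- Add an empty row. -/
def padSet (L : Finset ℕ) : Finset ℕ := insert 0 (succSet L)

theorem zero_notMem_succSet (L : Finset ℕ) : 0 ∉ succSet L := by simp [succSet]

theorem succ_mem_succSet {L : Finset ℕ} {k : ℕ} : k + 1 ∈ succSet L ↔ k ∈ L := by simp [succSet]

theorem succSet_injective : Function.Injective succSet := map_injective _

theorem padSet_injective : Function.Injective padSet := by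
  intro L L' h
  have := congrArg (fun s => s.erase 0) h
  simp only [padSet, erase_insert (zero_notMem_succSet _)] at this
  exact succSet_injective this

theorem exists_eq_succSet {L : Finset ℕ} (h : 0 ∉ L) : ∃ K, succSet K = L := by
  refine ⟨L.image (· - 1), ?_⟩
  ext k
  rcases k with _ | k
  · simp [zero_notMem_succSet, h]
  · rw [succ_mem_succSet, mem_image]
    constructor
    · rintro ⟨l, hl, rfl⟩
      have : l ≠ 0 := fun h' => h (h' ▸ hl)
      rwa [Nat.sub_add_cancel (by omega)]
    · exact fun hk => ⟨_, hk, rfl⟩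

theorem exists_eq_padSet {L : Finset ℕ} (h : 0 ∈ L) : ∃ K, padSet K = L := by
  obtain ⟨K, hK⟩ := exists_eq_succSet (notMem_erase 0 L)
  exact ⟨K, by rw [padSet, hK, insert_erase h]⟩

theorem card_succSet (L : Finset ℕ) : (succSet L).card = L.card := card_map _

theorem card_padSet (L : Finset ℕ) : (padSet L).card = L.card + 1 := by
  rw [padSet, card_insert_of_notMem (zero_notMem_succSet L), card_succSet]

theorem sum_succSet (L : Finset ℕ) : ∑ l ∈ succSet L, l = ∑ l ∈ L, l + L.card := by
  simp [succSet, sum_add_distrib]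

theorem gapCount_succSet (L : Finset ℕ) : gapCount (succSet L) = gapCount L + L.card := by
  have h0 := gapCount_add_choose L
  have h1 := gapCount_add_choose (succSet L)
  rw [card_succSet, sum_succSet] at h1
  omega

theorem gapCount_padSet (L : Finset ℕ) : gapCount (padSet L) = gapCount L := by
  have h0 := gapCount_add_choose L
  have h1 := gapCount_add_choose (padSet L)
  rw [card_padSet, padSet, sum_insert (zero_notMem_succSet L), sum_succSet,
    Nat.choose_succ_succ' _ 1, Nat.choose_one_right] at h1
  norm_num only at h1
  rw [padSet]
  omega

theorem hookProd_padSet {R : Type*} [CommMonoid R] (g : ℕ → R) (L : Finset ℕ) :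
    hookProd g (padSet L) = hookProd g L := by
  unfold hookProd
  rw [padSet, prod_insert (zero_notMem_succSet L), range_zero, empty_sdiff, prod_empty, one_mul]
  nth_rewrite 1 [succSet]
  rw [prod_map]
  refine prod_congr rfl fun l _ => ?_
  have : range (l + 1) \ insert 0 (succSet L) = (range l \ L).map (addRightEmbedding 1) := by
    ext k
    rcases k with _ | k
    · simp
    · simp [succ_mem_succSet]
  rw [addRightEmbedding_apply, this, prod_map]
  simp

theorem card_le_gapCount {L : Finset ℕ} (h0 : 0 ∉ L) : L.card ≤ gapCount L := by
  by_contra! h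
  exact h0 (zero_mem_of_mem_betaSets h (mem_betaSets.2 ⟨rfl, rfl⟩))

/-- The normalized beta-sets (all first-column hook-lengths) of the partitions of `n`. -/
def partSets (n : ℕ) : Finset (Finset ℕ) :=
  {L ∈ (range (2 * n)).powerset | 0 ∉ L ∧ gapCount L = n}

theorem mem_partSets {n : ℕ} {L : Finset ℕ} : L ∈ partSets n ↔ 0 ∉ L ∧ gapCount L = n := by
  simp only [partSets, mem_filter, mem_powerset, and_iff_right_iff_imp]
  rintro ⟨h0, rfl⟩ l hl
  have := card_le_gapCount h0
  have := lt_card_add_gapCount hl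
  exact mem_range.2 (by omega)

/-- A beta-set is normalized or contains `0`, and in the latter case it is a padding. -/
theorem sum_betaSets_succ {M : Type*} [AddCommMonoid M] (f : Finset ℕ → M) (m n : ℕ) :
    ∑ L ∈ betaSets (m + 1) n, f L
      = ∑ L ∈ partSets n with L.card = m + 1, f L + ∑ L ∈ betaSets m n, f (padSet L) := by
  have h1 : ∑ L ∈ betaSets m n, f (padSet L) = ∑ L ∈ betaSets (m + 1) n with 0 ∈ L, f L := by
    refine (sum_map (betaSets m n) ⟨padSet, padSet_injective⟩ f).symm.trans ?_
    refine sum_congr ?_ fun _ _ => rfl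
    ext L
    simp only [Finset.mem_map, Function.Embedding.coeFn_mk, mem_filter, mem_betaSets]
    constructor
    · rintro ⟨K, ⟨rfl, rfl⟩, rfl⟩
      exact ⟨⟨card_padSet K, gapCount_padSet K⟩, mem_insert_self _ _⟩
    · rintro ⟨⟨h1, h2⟩, h0⟩
      obtain ⟨K, rfl⟩ := exists_eq_padSet h0
      rw [card_padSet] at h1
      rw [gapCount_padSet] at h2
      exact ⟨K, ⟨by omega, h2⟩, rfl⟩
  have h2 : ∑ L ∈ partSets n with L.card = m + 1, f L = ∑ L ∈ betaSets (m + 1) n with 0 ∉ L, f L := by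
    refine sum_congr ?_ fun _ _ => rfl
    ext L
    simp only [mem_filter, mem_betaSets, mem_partSets]
    tauto
  rw [h1, h2, add_comm (∑ L ∈ _ with 0 ∉ L, f L)]
  exact (sum_filter_add_sum_filter_not _ _ _).symm

theorem sum_betaSets_eq {M : Type*} [AddCommMonoid M] {f : Finset ℕ → M}
    (hf : ∀ L, f (padSet L) = f L) (m n : ℕ) :
    ∑ L ∈ betaSets m n, f L = ∑ L ∈ partSets n with L.card ≤ m, f L := by
  induction m with
  | zero =>
    refine sum_congr ?_ fun _ _ => rfl
    ext L
    simp only [mem_filter, mem_betaSets, mem_partSets, Nat.le_zero, card_eq_zero]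
    constructor
    · rintro ⟨rfl, h⟩; exact ⟨⟨by simp, h⟩, rfl⟩
    · rintro ⟨h, rfl⟩; exact ⟨rfl, h.2⟩
  | succ m ih =>
    rw [sum_betaSets_succ, sum_congr rfl fun L _ => hf L, ih, ← sum_union]
    · refine sum_congr ?_ fun _ _ => rfl
      ext L
      simp only [mem_union, mem_filter]
      constructor
      · rintro (⟨h, h'⟩ | ⟨h, h'⟩)
        · exact ⟨h, h'.le⟩
        · exact ⟨h, by omega⟩
      · rintro ⟨h, h'⟩
        rcases Nat.lt_or_ge m L.card with h2 | h2
        · exact Or.inl ⟨h, by omega⟩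
        · exact Or.inr ⟨h, h2⟩
    · rw [disjoint_left]
      intro L
      simp only [mem_filter]
      rintro ⟨_, h⟩ ⟨_, h'⟩
      omega

/-- A partition of `n` has at most `n` rows, so `m ≥ n` beads represent all of them. -/
theorem sum_betaSets_eq_sum_partSets {M : Type*} [AddCommMonoid M] {f : Finset ℕ → M}
    (hf : ∀ L, f (padSet L) = f L) {m n : ℕ} (h : n ≤ m) :
    ∑ L ∈ betaSets m n, f L = ∑ L ∈ partSets n, f L := by
  rw [sum_betaSets_eq hf, filter_true_of_mem]
  intro L hL
  obtain ⟨h0, rfl⟩ := mem_partSets.1 hL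
  exact (card_le_gapCount h0).trans h

theorem partSets_zero : partSets 0 = {∅} := by
  ext L
  rw [mem_partSets, mem_singleton]
  constructor
  · rintro ⟨h0, h⟩
    have := card_le_gapCount h0
    exact card_eq_zero.1 (by omega)
  · rintro rfl
    simp [gapCount]

/-- The sum of the reciprocals of the hook products over the partitions of `n`. -/
noncomputable def hookSum (n : ℕ) : ℝ := ∑ L ∈ partSets n, hookWeight L

theorem hookSum_nonneg (n : ℕ) : 0 ≤ hookSum n := sum_nonneg fun L _ => hookWeight_nonneg L

theorem hookSum_zero : hookSum 0 = 1 := by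
  simp [hookSum, partSets_zero, hookWeight, hookProd]

theorem hookSum_one : hookSum 1 = 1 := by
  have h := sum_hookWeight_betaSets_one (m := 1) one_pos
  have hp : ∀ L, hookWeight (padSet L) = hookWeight L := fun L => hookProd_padSet _ L
  rw [sum_betaSets_eq_sum_partSets hp le_rfl, sum_betaSets_eq_sum_partSets hp zero_le_one] at h
  exact h.trans hookSum_zero

theorem hookSum_succ_succ (n : ℕ) :
    ((n : ℝ) + 2) * hookSum (n + 2) = hookSum (n + 1) + hookSum n := by
  have h := sum_hookWeight_betaSets_succ (m := n + 2) (n := n) (by omega)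
  have hp : ∀ L, hookWeight (padSet L) = hookWeight L := fun L => hookProd_padSet _ L
  rwa [sum_betaSets_eq_sum_partSets hp le_rfl, sum_betaSets_eq_sum_partSets hp (by omega),
    sum_betaSets_eq_sum_partSets hp (by omega)] at h

/-- The Taylor coefficients of `exp (y ^ 2 / 2)`. -/
noncomputable def expSqCoeff (k : ℕ) : ℝ := if Even k then ((2 : ℝ) ^ (k / 2) * (k / 2).factorial)⁻¹ else 0

theorem expSqCoeff_succ_succ (k : ℕ) : ((k : ℝ) + 2) * expSqCoeff (k + 2) = expSqCoeff k := by
  unfold expSqCoeff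
  by_cases h : Even k
  · have h2 : Even (k + 2) := h.add even_two
    obtain ⟨j, rfl⟩ := h
    rw [if_pos h2, if_pos ⟨j, rfl⟩, show (j + j + 2) / 2 = j + 1 by omega,
      show (j + j) / 2 = j by omega, Nat.factorial_succ]
    push_cast
    have : (j : ℝ) + 1 ≠ 0 := by positivity
    field_simp
    ring
  · have h2 : ¬ Even (k + 2) := by simpa [Nat.even_add] using h
    rw [if_neg h, if_neg h2, mul_zero]

/-- The right side is the Taylor coefficient of `exp y * exp (y ^ 2 / 2)`. Splitting `n + 2` as `p.1
+ p.2` differentiates the two factors and gives the recursion of `hookSum`. -/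
theorem hookSum_eq (n : ℕ) :
    hookSum n = ∑ p ∈ antidiagonal n, ((p.1.factorial : ℝ))⁻¹ * expSqCoeff p.2 := by
  have hrec : ∀ n : ℕ, ((n : ℝ) + 2) *
      ∑ p ∈ antidiagonal (n + 2), ((p.1.factorial : ℝ))⁻¹ * expSqCoeff p.2
      = ∑ p ∈ antidiagonal (n + 1), ((p.1.factorial : ℝ))⁻¹ * expSqCoeff p.2
        + ∑ p ∈ antidiagonal n, ((p.1.factorial : ℝ))⁻¹ * expSqCoeff p.2 := by
    intro n
    have h1 : ((n : ℝ) + 2) *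
        ∑ p ∈ antidiagonal (n + 2), ((p.1.factorial : ℝ))⁻¹ * expSqCoeff p.2
        = ∑ p ∈ antidiagonal (n + 2), p.1 * ((p.1.factorial : ℝ))⁻¹ * expSqCoeff p.2
          + ∑ p ∈ antidiagonal (n + 2), ((p.1.factorial : ℝ))⁻¹ * (p.2 * expSqCoeff p.2) := by
      rw [mul_sum, ← sum_add_distrib]
      refine sum_congr rfl fun p hp => ?_
      have : ((p.1 + p.2 : ℕ) : ℝ) = (n + 2 : ℕ) := by rw [mem_antidiagonal.1 hp]
      push_cast at this
      rw [← this]; ring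
    have e1 : expSqCoeff 1 = 0 := by simp [expSqCoeff]
    rw [h1]
    congr 1
    · rw [Nat.sum_antidiagonal_succ]
      simp only [Nat.cast_zero, zero_mul, zero_add]
      refine sum_congr rfl fun p _ => ?_
      rw [Nat.factorial_succ]
      push_cast
      have : (p.1 : ℝ) + 1 ≠ 0 := by positivity
      field_simp
    · rw [Nat.sum_antidiagonal_succ', Nat.sum_antidiagonal_succ']
      simp only [Nat.cast_zero, zero_mul, zero_add, e1, mul_zero]
      refine sum_congr rfl fun p _ => ?_
      rw [← expSqCoeff_succ_succ p.2]
      push_cast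
      ring
  induction n using Nat.strong_induction_on with
  | _ n ih =>
    rcases n with _ | _ | n
    · simp [hookSum_zero, expSqCoeff]
    · simp [hookSum_one, expSqCoeff, Nat.antidiagonal_succ]
    · have h := hookSum_succ_succ n
      rw [ih (n + 1) (by omega), ih n (by omega), ← hrec n] at h
      exact mul_left_cancel₀ (by positivity) h

theorem hasSum_expSqCoeff (y : ℂ) :
    HasSum (fun k => (expSqCoeff k : ℂ) * y ^ k) (Complex.exp (y ^ 2 / 2)) := by
  have h1 : HasSum (fun j : ℕ => (y ^ 2 / 2) ^ j / (j.factorial : ℂ)) (Complex.exp (y ^ 2 / 2)) := by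
    rw [Complex.exp_eq_exp_ℂ]
    exact NormedSpace.expSeries_div_hasSum_exp _
  have hinj : Function.Injective fun j : ℕ => 2 * j := fun a b h => by simpa using h
  rw [← hinj.hasSum_iff]
  · convert h1 using 2 with j
    simp only [Function.comp, expSqCoeff, even_two, Even.mul_right, if_true]
    rw [show 2 * j / 2 = j by omega, div_pow, pow_mul]
    push_cast
    field_simp
  · intro k hk
    have : ¬ Even k := by
      rintro ⟨j, rfl⟩
      exact hk ⟨j, by simp; ring⟩
    simp [expSqCoeff, this]

theorem hasSum_hookSum (y : ℂ) :
    HasSum (fun n => (hookSum n : ℂ) * y ^ n) (Complex.exp (y + y ^ 2 / 2)) ∧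
      Summable fun n => hookSum n * ‖y‖ ^ n := by
  have hu : HasSum (fun i : ℕ => y ^ i / (i.factorial : ℂ)) (Complex.exp y) := by
    rw [Complex.exp_eq_exp_ℂ]
    exact NormedSpace.expSeries_div_hasSum_exp _
  have hv := hasSum_expSqCoeff y
  have key : ∀ n, ∑ p ∈ antidiagonal n, (y ^ p.1 / (p.1.factorial : ℂ)) * ((expSqCoeff p.2 : ℂ) * y ^ p.2)
      = (hookSum n : ℂ) * y ^ n := by
    intro n
    rw [hookSum_eq]
    push_cast
    rw [sum_mul]
    refine sum_congr rfl fun p hp => ?_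
    rw [← mem_antidiagonal.1 hp, pow_add]
    field_simp
  have hsum := summable_norm_sum_mul_antidiagonal_of_summable_norm hu.summable.norm hv.summable.norm
  have heq := tsum_mul_tsum_eq_tsum_sum_antidiagonal_of_summable_norm hu.summable.norm hv.summable.norm
  simp only [key] at hsum heq
  rw [hu.tsum_eq, hv.tsum_eq, ← Complex.exp_add] at heq
  refine ⟨heq ▸ hsum.of_norm.hasSum, ?_⟩
  simpa [abs_of_nonneg (hookSum_nonneg _)] using hsum

/-! ### Sums over all partitions -/

/-- Normalized beta-sets, that is, partitions. -/
abbrev BetaSet : Type := {L : Finset ℕ // 0 ∉ L}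

/-- The partitions of size less than `M`. -/
def smallSets (M : ℕ) : Finset BetaSet := ((range M).biUnion partSets).subtype _

theorem mem_smallSets {M : ℕ} {L : BetaSet} : L ∈ smallSets M ↔ gapCount L.1 < M := by
  simp only [smallSets, mem_subtype, mem_biUnion, mem_range, mem_partSets]
  exact ⟨fun ⟨n, hn, _, h⟩ => h ▸ hn, fun h => ⟨_, h, L.2, rfl⟩⟩

theorem sum_smallSets {R : Type*} [AddCommMonoid R] (f : Finset ℕ → R) (M : ℕ) :
    ∑ L ∈ smallSets M, f L.1 = ∑ n ∈ range M, ∑ L ∈ partSets n, f L := by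
  rw [← sum_biUnion]
  · refine (sum_map _ (Function.Embedding.subtype _) f).symm.trans ?_
    rw [smallSets, subtype_map, filter_true_of_mem]
    intro L hL
    obtain ⟨n, _, h⟩ := mem_biUnion.1 hL
    exact (mem_partSets.1 h).1
  · intro n _ m _ hnm
    rw [Function.onFun, disjoint_left]
    intro L h1 h2
    exact hnm ((mem_partSets.1 h1).2.symm.trans (mem_partSets.1 h2).2)

theorem tendsto_smallSets : Tendsto smallSets atTop atTop := by
  refine tendsto_atTop_finset_of_monotone ?_ fun L => ⟨gapCount L.1 + 1, mem_smallSets.2 (by omega)⟩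
  intro m n h L hL
  exact mem_smallSets.2 ((mem_smallSets.1 hL).trans_le h)

theorem summable_betaSet {f : Finset ℕ → ℝ} (hf : ∀ L, 0 ≤ f L)
    (h : Summable fun n => ∑ L ∈ partSets n, f L) : Summable fun L : BetaSet => f L.1 := by
  refine summable_of_sum_le (fun L => hf L.1) (c := ∑' n, ∑ L ∈ partSets n, f L) fun u => ?_
  have h1 : u ⊆ smallSets (u.sup (fun L => gapCount L.1) + 1) := fun L hL =>
    mem_smallSets.2 (Nat.lt_succ_of_le (le_sup (f := fun L : BetaSet => gapCount L.1) hL))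
  refine (sum_le_sum_of_subset_of_nonneg h1 fun L _ _ => hf L.1).trans ?_
  rw [sum_smallSets]
  exact h.sum_le_tsum _ fun n _ => sum_nonneg fun L _ => hf L

theorem summable_hookWeight (y : ℂ) :
    Summable fun L : BetaSet => ‖(hookWeight L.1 : ℂ) * y ^ gapCount L.1‖ := by
  refine summable_betaSet (f := fun L => ‖(hookWeight L : ℂ) * y ^ gapCount L‖)
    (fun _ => norm_nonneg _) ?_
  convert (hasSum_hookSum y).2 using 2 with n
  rw [hookSum, sum_mul]
  refine sum_congr rfl fun L hL => ?_
  rw [(mem_partSets.1 hL).2, norm_mul, norm_pow, Complex.norm_real,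
    Real.norm_of_nonneg (hookWeight_nonneg L)]

theorem tsum_hookWeight (y : ℂ) :
    ∑' L : BetaSet, (hookWeight L.1 : ℂ) * y ^ gapCount L.1 = Complex.exp (y + y ^ 2 / 2) := by
  have h1 := (summable_hookWeight y).of_norm.hasSum.comp tendsto_smallSets
  refine tendsto_nhds_unique h1 ?_
  convert (hasSum_hookSum y).1.tendsto_sum_nat using 2 with M
  rw [Function.comp, sum_smallSets fun L => (hookWeight L : ℂ) * y ^ gapCount L]
  refine sum_congr rfl fun n _ => ?_
  rw [hookSum]
  push_cast
  rw [sum_mul]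
  exact sum_congr rfl fun L hL => by rw [(mem_partSets.1 hL).2]

/-! ### The generating function of partitions -/

/-- With `m + 1` rows, either all are nonempty and one box can be taken from each, or an empty row
can be dropped. -/
theorem card_betaSets_succ (m n : ℕ) :
    (betaSets (m + 1) (n + (m + 1))).card
      = (betaSets (m + 1) n).card + (betaSets m (n + (m + 1))).card := by
  have h := sum_betaSets_succ (fun _ => 1) m (n + (m + 1))
  simp only [sum_const, smul_eq_mul, mul_one] at h
  rw [h]
  congr 1
  symm
  refine card_bij (fun L _ => succSet L) ?_ (fun _ _ _ _ h => succSet_injective h) ?_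
  · intro L hL
    obtain ⟨h1, h2⟩ := mem_betaSets.1 hL
    simp [mem_partSets, zero_notMem_succSet, gapCount_succSet, card_succSet, h1, h2]
  · intro L hL
    simp only [mem_filter, mem_partSets] at hL
    obtain ⟨⟨h0, h1⟩, h2⟩ := hL
    obtain ⟨K, rfl⟩ := exists_eq_succSet h0
    rw [gapCount_succSet] at h1
    rw [card_succSet] at h2
    exact ⟨K, mem_betaSets.2 ⟨h2, by omega⟩, rfl⟩

theorem card_betaSets_succ_of_le {m n : ℕ} (h : n ≤ m) :
    (betaSets (m + 1) n).card = (betaSets m n).card := by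
  have h1 := sum_betaSets_eq_sum_partSets (f := fun _ => 1) (fun _ => rfl) h
  have h2 := sum_betaSets_eq_sum_partSets (f := fun _ => 1) (fun _ => rfl) (h.trans m.le_succ)
  simpa using h2.trans h1.symm

theorem card_betaSets_le (m n : ℕ) : (betaSets m n).card ≤ (partSets n).card := by
  have h1 := sum_betaSets_eq (f := fun _ => 1) (fun _ => rfl) m n
  simp only [sum_const, smul_eq_mul, mul_one] at h1
  rw [h1]
  exact card_filter_le _ _

/-- The series for at most `m` rows becomes that for `m + 1` rows on division by `1 - Q ^ (m + 1)`.
In the limit each coefficient is eventually constant, and the series over all partitions dominates.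
-/
theorem tsum_pow_gapCount {Q : ℂ} (hQ : ‖Q‖ < 1)
    (hs : Summable fun L : BetaSet => ‖Q ^ gapCount L.1‖) :
    qPochhammerInf Q Q * ∑' L : BetaSet, Q ^ gapCount L.1 = 1 := by
  have hsum : ∀ M, ∑ L ∈ smallSets M, ‖Q ^ gapCount L.1‖
      = ∑ n ∈ range M, (partSets n).card * ‖Q‖ ^ n := by
    intro M
    rw [sum_smallSets fun L => ‖Q ^ gapCount L‖]
    refine sum_congr rfl fun n _ => ?_
    rw [← nsmul_eq_mul, ← sum_const]
    exact sum_congr rfl fun L hL => by rw [(mem_partSets.1 hL).2, norm_pow]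
  have hpart : Summable fun n => ((partSets n).card : ℝ) * ‖Q‖ ^ n := by
    refine summable_of_sum_range_le (c := ∑' L : BetaSet, ‖Q ^ gapCount L.1‖)
      (fun n => by positivity) fun M => ?_
    rw [← hsum]
    exact hs.sum_le_tsum _ fun _ _ => norm_nonneg _
  have hbd : ∀ m n, ‖((betaSets m n).card : ℂ) * Q ^ n‖ ≤ (partSets n).card * ‖Q‖ ^ n := by
    intro m n
    rw [norm_mul, norm_pow, Complex.norm_natCast]
    exact mul_le_mul_of_nonneg_right (Nat.cast_le.2 (card_betaSets_le m n)) (by positivity)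
  have hm : ∀ m, Summable fun n => ((betaSets m n).card : ℂ) * Q ^ n := fun m =>
    Summable.of_norm_bounded hpart (hbd m)
  have hrec : ∀ m, (1 - Q * Q ^ m) * ∑' n, ((betaSets (m + 1) n).card : ℂ) * Q ^ n
      = ∑' n, ((betaSets m n).card : ℂ) * Q ^ n := by
    intro m
    have e1 := (hm (m + 1)).sum_add_tsum_nat_add (m + 1)
    have e2 := (hm m).sum_add_tsum_nat_add (m + 1)
    have e3 : ∑' n, ((betaSets (m + 1) (n + (m + 1))).card : ℂ) * Q ^ (n + (m + 1))
        = Q * Q ^ m * ∑' n, ((betaSets (m + 1) n).card : ℂ) * Q ^ n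
          + ∑' n, ((betaSets m (n + (m + 1))).card : ℂ) * Q ^ (n + (m + 1)) := by
      rw [← tsum_mul_left, ← ((hm (m + 1)).mul_left _).tsum_add
        ((summable_nat_add_iff (m + 1)).2 (hm m))]
      refine tsum_congr fun n => ?_
      rw [card_betaSets_succ]
      push_cast
      ring
    have e4 : ∑ n ∈ range (m + 1), ((betaSets (m + 1) n).card : ℂ) * Q ^ n
        = ∑ n ∈ range (m + 1), ((betaSets m n).card : ℂ) * Q ^ n :=
      sum_congr rfl fun n hn => by
        rw [card_betaSets_succ_of_le (Nat.lt_succ_iff.1 (mem_range.1 hn))]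
    rw [e3, e4] at e1
    linear_combination e2 - e1
  have hprod : ∀ m, (∏ j ∈ range m, (1 - Q * Q ^ j)) * ∑' n, ((betaSets m n).card : ℂ) * Q ^ n = 1 := by
    intro m
    induction m with
    | zero =>
      rw [prod_range_zero, one_mul, tsum_eq_single 0]
      · have h1 := sum_betaSets_eq_sum_partSets (f := fun _ => 1) (fun _ => rfl) (le_refl 0)
        simp only [sum_const, smul_eq_mul, mul_one] at h1
        rw [h1, partSets_zero]
        simp
      · intro n hn
        have : betaSets 0 n = ∅ := by
          rw [eq_empty_iff_forall_notMem]
          intro L hL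
          obtain ⟨h1, h2⟩ := mem_betaSets.1 hL
          rw [card_eq_zero.1 h1] at h2
          exact hn h2.symm
        simp [this]
    | succ m ih => rw [prod_range_succ, mul_assoc, hrec, ih]
  have hlim1 : Tendsto (fun m => ∏ j ∈ range m, (1 - Q * Q ^ j)) atTop (𝓝 (qPochhammerInf Q Q)) :=
    (multipliable_qPochhammerInf Q hQ).hasProd.tendsto_prod_nat
  have hlim2 : Tendsto (fun m => ∑' n, ((betaSets m n).card : ℂ) * Q ^ n) atTop
      (𝓝 (∑' n, ((partSets n).card : ℂ) * Q ^ n)) := by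
    refine tendsto_tsum_of_dominated_convergence hpart (fun n => ?_)
      (Eventually.of_forall fun m n => hbd m n)
    refine tendsto_const_nhds.congr' ?_
    filter_upwards [eventually_ge_atTop n] with m hmn
    have h1 := sum_betaSets_eq_sum_partSets (f := fun _ => 1) (fun _ => rfl) hmn
    simp only [sum_const, smul_eq_mul, mul_one] at h1
    rw [h1]
  have hval : ∑' L : BetaSet, Q ^ gapCount L.1 = ∑' n, ((partSets n).card : ℂ) * Q ^ n := by
    have h1 := hs.of_norm.hasSum.comp tendsto_smallSets
    have h2 : Summable fun n => ((partSets n).card : ℂ) * Q ^ n :=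
      Summable.of_norm (by simpa using hpart)
    refine tendsto_nhds_unique h1 ?_
    convert h2.hasSum.tendsto_sum_nat using 2 with M
    rw [Function.comp, sum_smallSets fun L => Q ^ gapCount L]
    refine sum_congr rfl fun n _ => ?_
    rw [← nsmul_eq_mul, ← sum_const]
    exact sum_congr rfl fun L hL => by rw [(mem_partSets.1 hL).2]
  rw [hval]
  refine tendsto_nhds_unique (hlim1.mul hlim2) ?_
  simp only [hprod]
  exact tendsto_const_nhds

end SelfConj

namespace SelfConj

open Finset

/-! ### Maya diagrams -/

/-- The Maya diagram with particles at `a ∈ p.1` and holes at `-1 - b`, `b ∈ p.2`. -/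
def mayaSet (p : Finset ℕ × Finset ℕ) : Set ℤ :=
  {n | (∃ a ∈ p.1, n = (a : ℤ)) ∨ ∃ b ∉ p.2, n = -1 - (b : ℤ)}

theorem natCast_mem_mayaSet {p : Finset ℕ × Finset ℕ} {a : ℕ} : (a : ℤ) ∈ mayaSet p ↔ a ∈ p.1 := by
  constructor
  · rintro (⟨a', h, h'⟩ | ⟨b, _, h'⟩)
    · rwa [Nat.cast_injective h']
    · omega
  · exact fun h => Or.inl ⟨a, h, rfl⟩

theorem neg_mem_mayaSet {p : Finset ℕ × Finset ℕ} {b : ℕ} :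
    -1 - (b : ℤ) ∈ mayaSet p ↔ b ∉ p.2 := by
  constructor
  · rintro (⟨a', _, h'⟩ | ⟨b', h, h'⟩)
    · omega
    · rwa [show b = b' by omega]
  · exact fun h => Or.inr ⟨b, h, rfl⟩

theorem int_cases (n : ℤ) : (∃ a : ℕ, n = a) ∨ ∃ b : ℕ, n = -1 - (b : ℤ) := by
  rcases lt_or_ge n 0 with h | h
  · exact Or.inr ⟨(-1 - n).toNat, by omega⟩
  · exact Or.inl ⟨n.toNat, by omega⟩

theorem mayaSet_eq_iff {p : Finset ℕ × Finset ℕ} {M : Set ℤ} :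
    mayaSet p = M ↔ (∀ a : ℕ, a ∈ p.1 ↔ (a : ℤ) ∈ M) ∧ ∀ b : ℕ, b ∈ p.2 ↔ -1 - (b : ℤ) ∉ M := by
  constructor
  · rintro rfl
    exact ⟨fun a => natCast_mem_mayaSet.symm, fun b => by rw [neg_mem_mayaSet, not_not]⟩
  · rintro ⟨h1, h2⟩
    ext n
    rcases int_cases n with ⟨a, rfl⟩ | ⟨b, rfl⟩
    · rw [natCast_mem_mayaSet, h1]
    · rw [neg_mem_mayaSet, h2, not_not]

theorem mayaSet_injective : Function.Injective mayaSet := by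
  intro p p' h
  obtain ⟨h1, h2⟩ := mayaSet_eq_iff.1 h
  ext x
  · rw [h1, natCast_mem_mayaSet]
  · rw [h2, neg_mem_mayaSet, not_not]

/-- The Maya diagram all of whose sites below `s` are filled, together with `s + L`. -/
def betaMaya (s : ℤ) (L : Finset ℕ) : Set ℤ := {n | n < s ∨ ∃ l ∈ L, n = (l : ℤ) + s}

theorem add_mem_betaMaya {s : ℤ} {L : Finset ℕ} {l : ℕ} : (l : ℤ) + s ∈ betaMaya s L ↔ l ∈ L := by
  constructor
  · rintro (h | ⟨l', h, h'⟩)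
    · omega
    · rwa [show l = l' by omega]
  · exact fun h => Or.inr ⟨l, h, rfl⟩

/-- As `0 ∉ L`, the site `s` is the lowest hole. -/
theorem betaMaya_injective {s s' : ℤ} {L L' : Finset ℕ} (h0 : 0 ∉ L) (h0' : 0 ∉ L')
    (h : betaMaya s L = betaMaya s' L') : s = s' ∧ L = L' := by
  have hs : s ∉ betaMaya s L := fun h => h0 (add_mem_betaMaya.1 (by simpa using h))
  have hs' : s' ∉ betaMaya s' L' := fun h => h0' (add_mem_betaMaya.1 (by simpa using h))
  have : s = s' := by
    rcases lt_trichotomy s s' with h1 | h1 | h1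
    · exact absurd (h ▸ Or.inl h1) hs
    · exact h1
    · exact absurd (h ▸ Or.inl h1) hs'
  subst this
  refine ⟨rfl, ?_⟩
  ext l
  rw [← add_mem_betaMaya (s := s), h, add_mem_betaMaya]

theorem exists_betaMaya_eq (p : Finset ℕ × Finset ℕ) :
    ∃ (s : ℤ) (L : Finset ℕ), 0 ∉ L ∧ mayaSet p = betaMaya s L := by
  classical
  have hA : ∀ n ∈ mayaSet p, n ≤ p.1.sup id := by
    rintro n (⟨a, h, rfl⟩ | ⟨b, _, rfl⟩)
    · exact_mod_cast le_sup (f := id) h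
    · omega
  have hB : ∀ n, n ∉ mayaSet p → -1 - ((p.2.sup id : ℕ) : ℤ) ≤ n := by
    intro n hn
    rcases int_cases n with ⟨a, rfl⟩ | ⟨b, rfl⟩
    · omega
    · rw [neg_mem_mayaSet, not_not] at hn
      have : b ≤ p.2.sup id := le_sup (f := id) hn
      omega
  obtain ⟨s, hs, hmin⟩ := Int.exists_least_of_bdd (P := fun n => n ∉ mayaSet p) ⟨_, hB⟩
    ⟨(p.1.sup id : ℕ) + 1, fun h => by have := hA _ h; omega⟩
  refine ⟨s, {l ∈ range ((p.1.sup id : ℕ) - s + 1).toNat | (l : ℤ) + s ∈ mayaSet p}, ?_, ?_⟩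
  · simp [hs]
  · ext n
    constructor
    · intro hn
      by_cases h : n < s
      · exact Or.inl h
      · refine Or.inr ⟨(n - s).toNat, ?_, by omega⟩
        have e : (((n - s).toNat : ℕ) : ℤ) + s = n := by omega
        rw [mem_filter, e]
        refine ⟨mem_range.2 ?_, hn⟩
        have := hA n hn
        omega
    · rintro (h | ⟨l, h, rfl⟩)
      · by_contra hn
        have := hmin n hn
        omega
      · exact (mem_filter.1 h).2

theorem exists_mayaSet_eq (s : ℤ) (L : Finset ℕ) : ∃ p, mayaSet p = betaMaya s L := by
  classical
  refine ⟨({a ∈ range (s.natAbs + L.sup id + 1) | (a : ℤ) ∈ betaMaya s L},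
    {b ∈ range (s.natAbs + 1) | -1 - (b : ℤ) ∉ betaMaya s L}), mayaSet_eq_iff.2 ⟨?_, ?_⟩⟩
  · intro a
    simp only [mem_filter, mem_range, and_iff_right_iff_imp]
    rintro (h | ⟨l, h, h'⟩)
    · omega
    · have : l ≤ L.sup id := le_sup (f := id) h
      omega
  · intro b
    simp only [mem_filter, mem_range, and_iff_right_iff_imp]
    intro h
    have : ¬ (-1 - (b : ℤ) < s) := fun h' => h (Or.inl h')
    omega

/-- Both sides sum the increments of `F` over the particles, relative to the sea filled below `0`.
The choices `F n = n` and `F n = n ^ 2` give the charge and the energy. -/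
theorem sum_mayaSet {p : Finset ℕ × Finset ℕ} {s : ℤ} {L : Finset ℕ}
    (h : mayaSet p = betaMaya s L) (F : ℤ → ℤ) :
    ∑ a ∈ p.1, (F (a + 1) - F a) - ∑ b ∈ p.2, (F (-1 - b + 1) - F (-1 - b))
      = ∑ l ∈ L, (F (l + s + 1) - F (l + s)) + (F s - F 0) := by
  -- Below `-K` all sites are filled in both descriptions, so only the finitely many particles from
  -- `-K` on are compared.
  obtain ⟨K, hKs, hKB⟩ : ∃ K : ℕ, -(K : ℤ) ≤ s ∧ p.2 ⊆ range K := by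
    refine ⟨s.natAbs + p.2.sup id + 1, by omega, fun b hb => mem_range.2 ?_⟩
    have : b ≤ p.2.sup id := le_sup (f := id) hb
    omega
  obtain ⟨m, rfl⟩ : ∃ m : ℕ, s = m + -(K : ℤ) := ⟨(s + K).toNat, by omega⟩
  have hset : p.1.image (fun a : ℕ => (a : ℤ)) ∪ (range K \ p.2).image (fun b : ℕ => -1 - (b : ℤ))
      = (range m).image (fun k : ℕ => (k : ℤ) + -(K : ℤ))
        ∪ L.image (fun l : ℕ => (l : ℤ) + (m + -(K : ℤ))) := by
    ext n
    have h1 : n ∈ mayaSet p ↔ n ∈ betaMaya (m + -(K : ℤ)) L := by rw [h]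
    have h2 : n ∈ p.1.image (fun a : ℕ => (a : ℤ)) ∪
        (range K \ p.2).image (fun b : ℕ => -1 - (b : ℤ)) ↔ -(K : ℤ) ≤ n ∧ n ∈ mayaSet p := by
      simp only [mem_union, mem_image, mem_sdiff, mem_range]
      constructor
      · rintro (⟨a, ha, rfl⟩ | ⟨b, hb, rfl⟩)
        · exact ⟨by omega, natCast_mem_mayaSet.2 ha⟩
        · exact ⟨by omega, neg_mem_mayaSet.2 hb.2⟩
      · rintro ⟨hn, ⟨a, ha, rfl⟩ | ⟨b, hb, rfl⟩⟩
        · exact Or.inl ⟨a, ha, rfl⟩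
        · exact Or.inr ⟨b, ⟨by omega, hb⟩, rfl⟩
    have h3 : n ∈ (range m).image (fun k : ℕ => (k : ℤ) + -(K : ℤ))
        ∪ L.image (fun l : ℕ => (l : ℤ) + (m + -(K : ℤ)))
        ↔ -(K : ℤ) ≤ n ∧ n ∈ betaMaya (m + -(K : ℤ)) L := by
      simp only [mem_union, mem_image, mem_range]
      constructor
      · rintro (⟨k, hk, rfl⟩ | ⟨l, hl, rfl⟩)
        · exact ⟨by omega, Or.inl (by omega)⟩
        · exact ⟨by omega, Or.inr ⟨l, hl, rfl⟩⟩
      · rintro ⟨hn, hn' | ⟨l, hl, rfl⟩⟩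
        · exact Or.inl ⟨(n + K).toNat, by omega, by omega⟩
        · exact Or.inr ⟨l, hl, rfl⟩
    rw [h2, h3, h1]
  have hsum := congrArg (fun S => ∑ n ∈ S, (F (n + 1) - F n)) hset
  rw [sum_union, sum_union, sum_image, sum_image, sum_image, sum_image] at hsum
  · have e1 : ∑ k ∈ range m, (F ((k : ℤ) + -(K : ℤ) + 1) - F (k + -(K : ℤ)))
        = F (m + -(K : ℤ)) - F (-(K : ℤ)) := by
      have := sum_range_sub (fun k : ℕ => F (k + -(K : ℤ))) m
      simp only [Nat.cast_zero, zero_add] at this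
      rw [← this]
      refine sum_congr rfl fun k _ => ?_
      push_cast
      congr 2
      ring
    have e2 : ∑ b ∈ range K, (F (-1 - (b : ℤ) + 1) - F (-1 - b)) = F 0 - F (-(K : ℤ)) := by
      have := sum_range_sub' (fun b : ℕ => F (-(b : ℤ))) K
      simp only [Nat.cast_zero, neg_zero] at this
      rw [← this]
      refine sum_congr rfl fun b _ => ?_
      push_cast
      congr 2 <;> ring
    have e3 := sum_sdiff (f := fun b : ℕ => F (-1 - (b : ℤ) + 1) - F (-1 - b)) hKB
    rw [e2] at e3
    rw [e1] at hsum
    linarith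
  · intro a _ b _ hab; simpa using hab
  · intro a _ b _ hab; simpa using hab
  · intro a _ b _ hab; simpa using hab
  · intro a _ b _ hab; simpa using hab
  · rw [disjoint_left]
    simp only [mem_image, mem_range]
    rintro n ⟨k, hk, rfl⟩ ⟨l, hl, hl'⟩
    omega
  · rw [disjoint_left]
    simp only [mem_image]
    rintro n ⟨k, hk, rfl⟩ ⟨l, hl, hl'⟩
    omega

theorem two_mul_choose_two_add (m : ℕ) : 2 * m.choose 2 + m = m * m := by
  induction m with
  | zero => rfl
  | succ m ih =>
    rw [Nat.choose_succ_succ' m 1, Nat.choose_one_right]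
    norm_num only
    linarith

/-- A particle above a hole; such pairs correspond to the boxes of a partition. -/
def invPairs (M : Set ℤ) : Set (ℤ × ℤ) := {p | p.1 ∈ M ∧ p.2 ∉ M ∧ p.2 < p.1}

theorem finprod_invPairs_betaMaya (g : ℕ → ℂ) (s : ℤ) (L : Finset ℕ) :
    ∏ᶠ p ∈ invPairs (betaMaya s L), g (p.1 - p.2).toNat = hookProd g L := by
  rw [hookProd, prod_sigma', ← finprod_mem_coe_finset]
  symm
  refine finprod_mem_eq_of_bijOn (fun x : (_ : ℕ) × ℕ => ((x.1 : ℤ) + s, (x.2 : ℤ) + s)) ⟨?_, ?_, ?_⟩ ?_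
  · rintro ⟨l, j⟩ h
    simp only [mem_coe, mem_sigma, mem_sdiff, mem_range] at h
    exact ⟨add_mem_betaMaya.2 h.1, fun h' => h.2.2 (add_mem_betaMaya.1 h'), by dsimp only; omega⟩
  · rintro ⟨l, j⟩ _ ⟨l', j'⟩ _ h
    simp only [Prod.mk.injEq, add_left_inj, Nat.cast_inj] at h
    rw [h.1, h.2]
  · rintro ⟨i, j⟩ ⟨h1, h2, h3⟩
    dsimp only at h1 h2 h3
    have hj : ¬ j < s := fun h => h2 (Or.inl h)
    rcases h1 with h1 | ⟨l, hl, rfl⟩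
    · omega
    · obtain ⟨k, rfl⟩ : ∃ k : ℕ, j = k + s := ⟨(j - s).toNat, by omega⟩
      rw [add_mem_betaMaya] at h2
      refine ⟨⟨l, k⟩, ?_, rfl⟩
      simp only [mem_coe, mem_sigma, mem_sdiff, mem_range]
      exact ⟨hl, by omega, h2⟩
  · rintro ⟨l, j⟩ h
    dsimp only
    congr 1
    omega

/-- The lowest hole `s` and the beads above it determine the diagram; recording `s + L.card` instead
of `s` makes the first coordinate the charge. -/
theorem exists_mayaEquiv : ∃ e : Finset ℕ × Finset ℕ ≃ ℤ × BetaSet,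
    ∀ p, mayaSet p = betaMaya ((e p).1 - (e p).2.1.card) (e p).2.1 := by
  choose s L h0 h using exists_betaMaya_eq
  refine ⟨Equiv.ofBijective (fun p => (s p + (L p).card, ⟨L p, h0 p⟩)) ⟨?_, ?_⟩, fun p => ?_⟩
  · intro p p' hp
    simp only [Prod.mk.injEq, Subtype.mk.injEq] at hp
    obtain ⟨h1, h2⟩ := hp
    rw [h2, add_left_inj] at h1
    exact mayaSet_injective (by rw [h, h, h1, h2])
  · rintro ⟨c, K, hK⟩
    obtain ⟨p, hp⟩ := exists_mayaSet_eq (c - K.card) K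
    obtain ⟨h1, h2⟩ := betaMaya_injective (h0 p) hK ((h p).symm.trans hp)
    refine ⟨p, ?_⟩
    simp only [h1, h2, sub_add_cancel]
  · change mayaSet p = betaMaya (s p + (L p).card - (L p).card) (L p)
    rw [add_sub_cancel_right]
    exact h p

/-- Charged Maya diagrams correspond to pairs of an integer charge and a partition. -/
noncomputable def mayaEquiv : Finset ℕ × Finset ℕ ≃ ℤ × BetaSet := exists_mayaEquiv.choose

theorem mayaSet_eq_betaMaya (p : Finset ℕ × Finset ℕ) :
    mayaSet p = betaMaya ((mayaEquiv p).1 - (mayaEquiv p).2.1.card) (mayaEquiv p).2.1 :=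
  exists_mayaEquiv.choose_spec p

theorem mayaEquiv_fst (p : Finset ℕ × Finset ℕ) :
    (mayaEquiv p).1 = (p.1.card : ℤ) - p.2.card := by
  have h := sum_mayaSet (mayaSet_eq_betaMaya p) id
  simp at h
  omega

theorem mayaEquiv_energy (p : Finset ℕ × Finset ℕ) :
    ∑ a ∈ p.1, (2 * (a : ℤ) + 1) + ∑ b ∈ p.2, (2 * (b : ℤ) + 1)
      = 2 * gapCount (mayaEquiv p).2.1 + (mayaEquiv p).1 ^ 2 := by
  have h := sum_mayaSet (mayaSet_eq_betaMaya p) (fun n => n ^ 2)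
  generalize (mayaEquiv p).1 = c at *
  generalize (mayaEquiv p).2.1 = L at *
  have e1 : ∑ a ∈ p.1, (((a : ℤ) + 1) ^ 2 - (a : ℤ) ^ 2) = ∑ a ∈ p.1, (2 * (a : ℤ) + 1) :=
    sum_congr rfl fun a _ => by ring
  have e2 : ∑ b ∈ p.2, ((-1 - (b : ℤ) + 1) ^ 2 - (-1 - (b : ℤ)) ^ 2)
      = -∑ b ∈ p.2, (2 * (b : ℤ) + 1) := by
    rw [← sum_neg_distrib]
    exact sum_congr rfl fun b _ => by ring
  have e3 : ∑ l ∈ L, (((l : ℤ) + (c - L.card) + 1) ^ 2 - ((l : ℤ) + (c - L.card)) ^ 2)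
      = 2 * ∑ l ∈ L, (l : ℤ) + (2 * (c - L.card) + 1) * L.card := by
    rw [mul_sum, mul_comm _ (L.card : ℤ), ← nsmul_eq_mul, ← sum_const, ← sum_add_distrib]
    exact sum_congr rfl fun b _ => by ring
  have e4 : (∑ l ∈ L, (l : ℤ)) = gapCount L + (L.card.choose 2 : ℕ) := by
    rw [← Nat.cast_sum, ← gapCount_add_choose]
    push_cast
    rfl
  have e5 : 2 * ((L.card.choose 2 : ℕ) : ℤ) + L.card = L.card * L.card := by
    exact_mod_cast two_mul_choose_two_add L.card
  rw [e1, e2, e3, e4] at h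
  linear_combination h + e5

theorem finprod_invPairs_mayaSet (g : ℕ → ℂ) (p : Finset ℕ × Finset ℕ) :
    ∏ᶠ x ∈ invPairs (mayaSet p), g (x.1 - x.2).toNat = hookProd g (mayaEquiv p).2.1 := by
  rw [mayaSet_eq_betaMaya, finprod_invPairs_betaMaya]

theorem finite_invPairs_mayaSet (p : Finset ℕ × Finset ℕ) : (invPairs (mayaSet p)).Finite := by
  refine ((Set.finite_Icc (-1 - ((p.2.sup id : ℕ) : ℤ)) (p.1.sup id : ℕ)).prod
    (Set.finite_Icc (-1 - ((p.2.sup id : ℕ) : ℤ)) (p.1.sup id : ℕ))).subset ?_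
  rintro ⟨i, j⟩ ⟨h1, h2, h3⟩
  dsimp only at h1 h2 h3
  have h4 : i ≤ (p.1.sup id : ℕ) := by
    rcases h1 with ⟨a, h, rfl⟩ | ⟨b, _, rfl⟩
    · exact_mod_cast le_sup (f := id) h
    · omega
  have h5 : -1 - ((p.2.sup id : ℕ) : ℤ) ≤ j := by
    rcases int_cases j with ⟨a, rfl⟩ | ⟨b, rfl⟩
    · omega
    · rw [neg_mem_mayaSet, not_not] at h2
      have : b ≤ p.2.sup id := le_sup (f := id) h2
      omega
  simp only [Set.mem_prod, Set.mem_Icc]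
  omega

end SelfConj

namespace SelfConj

open Finset

/-! ### Self-conjugate partitions and their diagonal arms -/

/-- The number of elements of `A` that are at least `k`. -/
def countGE (A : Finset ℕ) (k : ℕ) : ℕ := {a ∈ A | k ≤ a}.card

theorem countGE_eq_succ (A : Finset ℕ) (k : ℕ) :
    countGE A k = countGE A (k + 1) + if k ∈ A then 1 else 0 := by
  unfold countGE
  split_ifs with h
  · rw [← card_insert_of_notMem (s := {a ∈ A | k + 1 ≤ a}) (a := k) (by simp)]
    congr 1
    ext a
    simp only [mem_filter, mem_insert]
    grind
  · congr 1
    ext a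
    simp only [mem_filter]
    grind

theorem countGE_le_add (A : Finset ℕ) (k k' : ℕ) : countGE A k ≤ countGE A k' + (k' - k) := by
  unfold countGE
  have : (Ico k k').card = k' - k := Nat.card_Ico k k'
  rw [← this]
  refine (card_le_card ?_).trans (card_union_le _ _)
  intro a
  simp only [mem_filter, mem_union, mem_Ico]
  grind

theorem countGE_injective {A B : Finset ℕ} (h : ∀ k, countGE A k = countGE B k) : A = B := by
  ext a
  have h1 := countGE_eq_succ A a
  have h2 := countGE_eq_succ B a
  rw [h, h] at h1
  by_cases ha : a ∈ A <;> by_cases hb : a ∈ B <;> simp [ha, hb] at h1 h2 ⊢ <;> omega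

theorem mem_iff_lt_card_of_lower {S : Finset ℕ} (h : ∀ i ∈ S, ∀ j ≤ i, j ∈ S) (i : ℕ) :
    i ∈ S ↔ i < S.card := by
  constructor
  · intro hi
    have : range (i + 1) ⊆ S := fun j hj => h i hi j (by simpa [Nat.lt_succ_iff] using hj)
    simpa using card_le_card this
  · intro hi
    by_contra hn
    have : S ⊆ range i := fun j hj => mem_range.2 <| by
      by_contra hji
      exact hn (h j hj i (by omega))
    have := card_le_card this
    rw [card_range] at this
    omega

/-- The absolute difference of the coordinates of a box. -/
def offDiag (c : ℕ × ℕ) : ℕ := (c.1 - c.2) + (c.2 - c.1)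

/-- The self-conjugate partition with the given diagonal arm lengths. -/
def ofArms (A : Finset ℕ) : YoungDiagram where
  -- The diagonal at offset `k` has one box for each arm of length at least `k`; the square only
  -- ensures finiteness.
  cells := {c ∈ range (A.card + A.sup id + 1) ×ˢ range (A.card + A.sup id + 1) |
    min c.1 c.2 < countGE A (offDiag c)}
  isLowerSet := by
    rintro ⟨i, j⟩ ⟨i', j'⟩ h hc
    obtain ⟨hi, hj⟩ := Prod.mk_le_mk.1 h
    simp only [coe_filter, mem_product, mem_range, Set.mem_ofPred_eq] at hc ⊢
    have := countGE_le_add A (offDiag (i, j)) (offDiag (i', j'))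
    simp only [offDiag] at *
    refine ⟨by omega, ?_⟩
    have h2 := hc.2
    omega

theorem mem_ofArms {A : Finset ℕ} {c : ℕ × ℕ} :
    c ∈ ofArms A ↔ min c.1 c.2 < countGE A (offDiag c) := by
  rw [← YoungDiagram.mem_cells]
  simp only [ofArms, mem_filter, mem_product, mem_range, and_iff_right_iff_imp]
  intro h
  have h1 : countGE A (offDiag c) ≤ A.card := card_filter_le _ _
  obtain ⟨a, ha⟩ := card_pos.1 (Nat.zero_lt_of_lt h)
  obtain ⟨ha, hk⟩ := mem_filter.1 ha
  have h2 : a ≤ A.sup id := le_sup (f := id) ha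
  simp only [offDiag] at *
  omega

theorem isSelfConjugate_ofArms (A : Finset ℕ) : IsSelfConjugate (ofArms A) := by
  ext c
  rw [YoungDiagram.mem_cells, YoungDiagram.mem_cells, YoungDiagram.mem_transpose, mem_ofArms,
    mem_ofArms]
  simp only [offDiag, Prod.fst_swap, Prod.snd_swap]
  rw [min_comm, add_comm]

/-- The rows that meet the diagonal. -/
def diagRows (μ : YoungDiagram) : Finset ℕ := {c ∈ μ.cells | c.1 = c.2}.image Prod.fst

theorem mem_diagRows {μ : YoungDiagram} {d : ℕ} : d ∈ diagRows μ ↔ d < μ.rowLen d := by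
  rw [← YoungDiagram.mem_iff_lt_rowLen]
  simp only [diagRows, mem_image, mem_filter, YoungDiagram.mem_cells, Prod.exists]
  constructor
  · rintro ⟨a, b, ⟨h, rfl⟩, rfl⟩; exact h
  · exact fun h => ⟨d, d, ⟨h, rfl⟩, rfl⟩

/-- The arm lengths of the diagonal boxes. -/
def diagArms (μ : YoungDiagram) : Finset ℕ := (diagRows μ).image fun d => μ.rowLen d - d - 1

theorem diagArm_injOn (μ : YoungDiagram) :
    Set.InjOn (fun d => μ.rowLen d - d - 1) (diagRows μ : Set ℕ) := by
  intro d hd d' hd' h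
  have h1 := mem_diagRows.1 hd
  have h2 := mem_diagRows.1 hd'
  dsimp only at h
  rcases lt_trichotomy d d' with h3 | h3 | h3
  · have := μ.rowLen_anti d d' h3.le; omega
  · exact h3
  · have := μ.rowLen_anti d' d h3.le; omega

/-- Row lengths decrease, so the rows whose arm reaches offset `k` form an initial segment and are
determined by their number. -/
theorem lt_countGE_diagArms {μ : YoungDiagram} {i k : ℕ} :
    i < countGE (diagArms μ) k ↔ (i, i + k) ∈ μ := by
  have h1 : countGE (diagArms μ) k = {d ∈ diagRows μ | d + k < μ.rowLen d}.card := by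
    rw [countGE, diagArms, filter_image, card_image_of_injOn ((diagArm_injOn μ).mono
      (coe_subset.2 (filter_subset _ _)))]
    congr 1
    ext d
    simp only [mem_filter, and_congr_right_iff, mem_diagRows]
    omega
  rw [h1, ← mem_iff_lt_card_of_lower, mem_filter, mem_diagRows, YoungDiagram.mem_iff_lt_rowLen]
  · omega
  · intro i hi j hj
    have := μ.rowLen_anti j i hj
    simp only [mem_filter, mem_diagRows] at hi ⊢
    omega

theorem diagArms_ofArms (A : Finset ℕ) : diagArms (ofArms A) = A := by
  refine countGE_injective fun k => ?_
  have h : ∀ i, i < countGE (diagArms (ofArms A)) k ↔ i < countGE A k := by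
    intro i
    rw [lt_countGE_diagArms, mem_ofArms]
    simp [offDiag]
  have h1 := h (countGE A k)
  have h2 := h (countGE (diagArms (ofArms A)) k)
  omega

theorem mem_iff_lt_countGE {μ : YoungDiagram} (hμ : IsSelfConjugate μ) (c : ℕ × ℕ) :
    c ∈ μ ↔ min c.1 c.2 < countGE (diagArms μ) (offDiag c) := by
  rw [lt_countGE_diagArms]
  obtain ⟨i, j⟩ := c
  simp only [offDiag]
  rcases le_total i j with h | h
  · rw [min_eq_left h, show i + (i - j + (j - i)) = j by omega]
  · rw [min_eq_right h, show j + (i - j + (j - i)) = i by omega]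
    conv_lhs => rw [← hμ]
    rw [YoungDiagram.mem_transpose]
    rfl

theorem ofArms_diagArms {μ : YoungDiagram} (hμ : IsSelfConjugate μ) : ofArms (diagArms μ) = μ := by
  ext c
  rw [YoungDiagram.mem_cells, YoungDiagram.mem_cells, mem_ofArms, mem_iff_lt_countGE hμ]

/-- Self-conjugate partitions correspond to finite sets of diagonal arm lengths. -/
def armsEquiv : {μ : YoungDiagram // IsSelfConjugate μ} ≃ Finset ℕ where
  toFun μ := diagArms μ.1
  invFun A := ⟨ofArms A, isSelfConjugate_ofArms A⟩
  left_inv μ := Subtype.ext (ofArms_diagArms μ.2)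
  right_inv A := diagArms_ofArms A

theorem rowLen_eq_colLen {μ : YoungDiagram} (hμ : IsSelfConjugate μ) (i : ℕ) :
    μ.rowLen i = μ.colLen i := by
  rw [← YoungDiagram.rowLen_transpose, hμ]

/-- Group the boxes into diagonal hooks by their smaller coordinate: the row part has offsets `0, …,
a`, the column part `1, …, a`. -/
theorem sum_cells_offDiag {μ : YoungDiagram} (hμ : IsSelfConjugate μ) (f : ℕ → ℤ) :
    ∑ c ∈ μ.cells, f (offDiag c)
      = ∑ a ∈ diagArms μ, (∑ k ∈ range (a + 1), f k + ∑ k ∈ range a, f (k + 1)) := by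
  have hmem : ∀ i j, (i, j) ∈ μ.cells ↔ j < μ.rowLen i ∧ i < μ.rowLen j := by
    intro i j
    rw [YoungDiagram.mem_cells, rowLen_eq_colLen hμ j, ← YoungDiagram.mem_iff_lt_rowLen,
      ← YoungDiagram.mem_iff_lt_colLen, and_self]
  have hmaps : ∀ c ∈ μ.cells, min c.1 c.2 ∈ diagRows μ := by
    rintro ⟨i, j⟩ hc
    rw [mem_diagRows, ← YoungDiagram.mem_iff_lt_rowLen]
    exact μ.up_left_mem (min_le_left _ _) (min_le_right _ _) ((YoungDiagram.mem_cells _).1 hc)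
  rw [diagArms, sum_image (diagArm_injOn μ), ← sum_fiberwise_of_maps_to hmaps]
  refine sum_congr rfl fun d hd => ?_
  have hd := mem_diagRows.1 hd
  have hset : {c ∈ μ.cells | min c.1 c.2 = d}
      = (range (μ.rowLen d - d - 1 + 1)).image (fun k => (d, d + k))
        ∪ (range (μ.rowLen d - d - 1)).image (fun k => (d + (k + 1), d)) := by
    ext ⟨i, j⟩
    simp only [mem_filter, mem_union, mem_image, mem_range, Prod.mk.injEq]
    constructor
    · rintro ⟨hc, hm⟩
      have hc := (hmem i j).1 hc
      rcases le_or_gt i j with h | h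
      · rw [min_eq_left h] at hm
        subst hm
        exact Or.inl ⟨j - i, by omega, rfl, by omega⟩
      · rw [min_eq_right h.le] at hm
        subst hm
        exact Or.inr ⟨i - j - 1, by omega, by omega, rfl⟩
    · rintro (⟨k, hk, rfl, rfl⟩ | ⟨k, hk, rfl, rfl⟩)
      · refine ⟨?_, by omega⟩
        rw [YoungDiagram.mem_cells, YoungDiagram.mem_iff_lt_rowLen]
        omega
      · refine ⟨?_, by omega⟩
        rw [YoungDiagram.mem_cells, YoungDiagram.mem_iff_lt_colLen, ← rowLen_eq_colLen hμ]
        omega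
  rw [hset, sum_union, sum_image, sum_image]
  · congr 1
    · refine sum_congr rfl fun k _ => ?_
      simp [offDiag]
    · refine sum_congr rfl fun k _ => ?_
      simp [offDiag]
  · intro a _ b _ h; simpa using h
  · intro a _ b _ h; simpa using h
  · rw [disjoint_left]
    simp only [mem_image, mem_range]
    rintro c ⟨k, _, rfl⟩ ⟨k', _, h⟩
    simp only [Prod.mk.injEq] at h
    omega

theorem card_eq_sum_diagArms {μ : YoungDiagram} (hμ : IsSelfConjugate μ) :
    μ.card = ∑ a ∈ diagArms μ, (2 * a + 1) := by
  have h := sum_cells_offDiag hμ (fun _ => 1)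
  simp only [sum_const, mul_one, nsmul_eq_mul, card_range] at h
  zify
  rw [show (μ.card : ℤ) = (μ.cells.card : ℤ) from rfl, h]
  refine sum_congr rfl fun a _ => ?_
  push_cast
  ring

theorem bgRank_eq_sum_diagArms {μ : YoungDiagram} (hμ : IsSelfConjugate μ) :
    bgRank μ = ∑ a ∈ diagArms μ, (-1) ^ a := by
  have h1 : bgRank μ = ∑ c ∈ μ.cells, (-1) ^ offDiag c := by
    refine sum_congr rfl fun c _ => ?_
    refine neg_one_pow_congr ?_
    simp only [offDiag, Nat.even_iff]
    omega
  rw [h1, sum_cells_offDiag hμ fun k => (-1) ^ k]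
  have h2 : ∀ a : ℕ, ∑ k ∈ range (a + 1), (-1 : ℤ) ^ k + ∑ k ∈ range a, (-1) ^ (k + 1)
      = (-1) ^ a := by
    intro a
    induction a with
    | zero => simp
    | succ a ih =>
      rw [sum_range_succ _ (a + 1), sum_range_succ (fun k => (-1 : ℤ) ^ (k + 1)) a]
      linear_combination ih
  exact sum_congr rfl fun a _ => h2 a

/-! ### Hooks and Maya diagrams -/

/-- The hook joins the boundary step ending row `i` to the one ending column `j`; its length is the
distance between their positions. -/
theorem hookLength_eq {μ : YoungDiagram} {i j : ℕ} (h : (i, j) ∈ μ) :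
    (hookLength μ (i, j) : ℤ) = (μ.rowLen i - i - 1) - (j - μ.colLen j) := by
  have h1 := YoungDiagram.mem_iff_lt_rowLen.1 h
  have h2 := YoungDiagram.mem_iff_lt_colLen.1 h
  have hset : {u ∈ μ.cells | u = (i, j) ∨ (u.2 = (i, j).2 ∧ (i, j).1 < u.1)
      ∨ (u.1 = (i, j).1 ∧ (i, j).2 < u.2)}
      = (Ico i (μ.colLen j)).image (fun k => (k, j))
        ∪ (Ico (j + 1) (μ.rowLen i)).image (fun k => (i, k)) := by
    ext ⟨a, b⟩
    simp only [mem_filter, mem_union, mem_image, mem_Ico, Prod.mk.injEq, YoungDiagram.mem_cells]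
    constructor
    · rintro ⟨hc, ⟨rfl, rfl⟩ | ⟨rfl, hlt⟩ | ⟨rfl, hlt⟩⟩
      · exact Or.inl ⟨a, ⟨le_rfl, h2⟩, rfl, rfl⟩
      · exact Or.inl ⟨a, ⟨hlt.le, YoungDiagram.mem_iff_lt_colLen.1 hc⟩, rfl, rfl⟩
      · exact Or.inr ⟨b, ⟨hlt, YoungDiagram.mem_iff_lt_rowLen.1 hc⟩, rfl, rfl⟩
    · rintro (⟨k, hk, rfl, rfl⟩ | ⟨k, hk, rfl, rfl⟩)
      · refine ⟨YoungDiagram.mem_iff_lt_colLen.2 hk.2, ?_⟩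
        omega
      · refine ⟨YoungDiagram.mem_iff_lt_rowLen.2 hk.2, ?_⟩
        omega
  rw [hookLength, hset, card_union_of_disjoint, card_image_of_injective, card_image_of_injective,
    Nat.card_Ico, Nat.card_Ico]
  · omega
  · intro a b h; simpa using h
  · intro a b h; simpa using h
  · rw [disjoint_left]
    simp only [mem_image, mem_Ico]
    rintro c ⟨k, hk, rfl⟩ ⟨k', hk', h⟩
    simp only [Prod.mk.injEq] at h
    omega

theorem rowEdge_ne_colEdge (μ : YoungDiagram) (i j : ℕ) :
    (μ.rowLen i : ℤ) - i - 1 ≠ j - μ.colLen j := by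
  by_cases h : (i, j) ∈ μ
  · have h1 := YoungDiagram.mem_iff_lt_rowLen.1 h
    have h2 := YoungDiagram.mem_iff_lt_colLen.1 h
    omega
  · have h1 := mt YoungDiagram.mem_iff_lt_rowLen.2 h
    have h2 := mt YoungDiagram.mem_iff_lt_colLen.2 h
    omega

/-- Let `i` be the first row with edge at most `n`. If that edge is not `n`, then column `n + i` has
length exactly `i` and its edge is `n`. -/
theorem exists_rowEdge_or_colEdge (μ : YoungDiagram) (n : ℤ) :
    (∃ i : ℕ, n = μ.rowLen i - i - 1) ∨ ∃ j : ℕ, n = j - μ.colLen j := by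
  classical
  have hex : ∃ i : ℕ, (μ.rowLen i : ℤ) - i - 1 ≤ n := by
    refine ⟨(μ.rowLen 0 - n).toNat, ?_⟩
    have := μ.rowLen_anti 0 (μ.rowLen 0 - n).toNat (Nat.zero_le _)
    omega
  set i := Nat.find hex with hi
  have h1 : (μ.rowLen i : ℤ) - i - 1 ≤ n := Nat.find_spec hex
  rcases h1.eq_or_lt with h | h
  · exact Or.inl ⟨i, h.symm⟩
  · right
    refine ⟨(n + i).toNat, ?_⟩
    have h2 : (i, (n + i).toNat) ∉ μ := by
      rw [YoungDiagram.mem_iff_lt_rowLen]; omega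
    rw [YoungDiagram.mem_iff_lt_colLen] at h2
    rcases Nat.eq_zero_or_pos i with h0 | h0
    · omega
    · have h3 := Nat.find_min hex (m := i - 1) (by omega)
      have h4 : (i - 1, (n + i).toNat) ∈ μ := by
        rw [YoungDiagram.mem_iff_lt_rowLen]; omega
      rw [YoungDiagram.mem_iff_lt_colLen] at h4
      omega

theorem mem_mayaSet_diagArms {μ : YoungDiagram} (hμ : IsSelfConjugate μ) (n : ℤ) :
    n ∈ mayaSet (diagArms μ, diagArms μ) ↔ ∃ i : ℕ, n = μ.rowLen i - i - 1 := by
  have hA : ∀ a : ℕ, a ∈ diagArms μ ↔ ∃ i : ℕ, (a : ℤ) = μ.rowLen i - i - 1 := by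
    intro a
    simp only [diagArms, mem_image, mem_diagRows]
    exact ⟨fun ⟨d, hd, h⟩ => ⟨d, by omega⟩, fun ⟨d, h⟩ => ⟨d, by omega, by omega⟩⟩
  rcases int_cases n with ⟨a, rfl⟩ | ⟨b, rfl⟩
  · rw [natCast_mem_mayaSet, hA]
  · rw [neg_mem_mayaSet, hA]
    constructor
    · intro h
      refine (exists_rowEdge_or_colEdge μ _).resolve_right ?_
      rintro ⟨j, hj⟩
      rw [← rowLen_eq_colLen hμ] at hj
      exact h ⟨j, by omega⟩
    · rintro ⟨i, hi⟩ ⟨j, hj⟩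
      refine rowEdge_ne_colEdge μ i j ?_
      rw [← rowLen_eq_colLen hμ]
      omega

/-- Row edges are the particles and column edges the holes, so a box is a particle above a hole. -/
theorem prod_hookLength {μ : YoungDiagram} (hμ : IsSelfConjugate μ) (g : ℕ → ℂ) :
    ∏ c ∈ μ.cells, g (hookLength μ c)
      = ∏ᶠ p ∈ invPairs (mayaSet (diagArms μ, diagArms μ)), g (p.1 - p.2).toNat := by
  have hnot : ∀ n, n ∉ mayaSet (diagArms μ, diagArms μ) ↔ ∃ j : ℕ, n = j - μ.colLen j := by
    intro n
    rw [mem_mayaSet_diagArms hμ]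
    constructor
    · exact (exists_rowEdge_or_colEdge μ n).resolve_left
    · rintro ⟨j, rfl⟩ ⟨i, hi⟩
      exact rowEdge_ne_colEdge μ i j hi.symm
  rw [← finprod_mem_coe_finset]
  refine finprod_mem_eq_of_bijOn
    (fun c : ℕ × ℕ => ((μ.rowLen c.1 : ℤ) - c.1 - 1, (c.2 : ℤ) - μ.colLen c.2)) ⟨?_, ?_, ?_⟩ ?_
  · rintro ⟨i, j⟩ h
    rw [mem_coe, YoungDiagram.mem_cells] at h
    have h1 := YoungDiagram.mem_iff_lt_rowLen.1 h
    have h2 := YoungDiagram.mem_iff_lt_colLen.1 h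
    exact ⟨(mem_mayaSet_diagArms hμ _).2 ⟨i, rfl⟩, (hnot _).2 ⟨j, rfl⟩, by dsimp only; omega⟩
  · rintro ⟨i, j⟩ _ ⟨i', j'⟩ _ h
    simp only [Prod.mk.injEq] at h
    obtain ⟨h1, h2⟩ := h
    have e1 : i = i' := by
      rcases lt_trichotomy i i' with h | h | h
      · have := μ.rowLen_anti i i' h.le; omega
      · exact h
      · have := μ.rowLen_anti i' i h.le; omega
    have e2 : j = j' := by
      rcases lt_trichotomy j j' with h | h | h
      · have := μ.colLen_anti j j' h.le; omega
      · exact h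
      · have := μ.colLen_anti j' j h.le; omega
    rw [e1, e2]
  · rintro ⟨m, n⟩ ⟨h1, h2, h3⟩
    dsimp only at h1 h2 h3
    obtain ⟨i, rfl⟩ := (mem_mayaSet_diagArms hμ _).1 h1
    obtain ⟨j, rfl⟩ := (hnot _).1 h2
    refine ⟨(i, j), ?_, rfl⟩
    rw [mem_coe, YoungDiagram.mem_cells]
    by_contra h
    have h1 := mt YoungDiagram.mem_iff_lt_rowLen.2 h
    have h2 := mt YoungDiagram.mem_iff_lt_colLen.2 h
    omega
  · rintro ⟨i, j⟩ h
    rw [mem_coe, YoungDiagram.mem_cells] at h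
    dsimp only
    rw [← hookLength_eq h, Int.toNat_natCast]

end SelfConj

namespace SelfConj

open Finset

/-! ### Splitting into residue classes -/

/-- The `k`-th natural number congruent to `r` modulo `2 * u`. -/
def loSite {u : ℕ} (r : Fin u) (k : ℕ) : ℕ := r + 2 * u * k

/-- The `k`-th natural number congruent to `-1 - r` modulo `2 * u`. -/
def hiSite {u : ℕ} (r : Fin u) (k : ℕ) : ℕ := 2 * u - 1 - r + 2 * u * k

/-- The integer version of `loSite`. -/
def intSite {u : ℕ} (r : Fin u) (k : ℤ) : ℤ := (r : ℕ) + 2 * u * k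

theorem intSite_natCast {u : ℕ} (r : Fin u) (k : ℕ) : intSite r k = loSite r k := by
  simp [intSite, loSite]

theorem intSite_neg {u : ℕ} (r : Fin u) (k : ℕ) :
    intSite r (-1 - (k : ℤ)) = -1 - (hiSite r k : ℤ) := by
  have h : ((2 * u - 1 - r : ℕ) : ℤ) = 2 * u - 1 - (r : ℕ) := by have := r.2; omega
  rw [intSite, hiSite, Nat.cast_add, h]
  push_cast
  ring

theorem add_mul_inj {T ρ ρ' k k' : ℤ} (h0 : 0 ≤ ρ) (h1 : ρ < T) (h0' : 0 ≤ ρ') (h1' : ρ' < T)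
    (h : ρ + T * k = ρ' + T * k') : ρ = ρ' ∧ k = k' := by
  have h2 := congrArg (· % T) h
  simp only [Int.add_mul_emod_self_left, Int.emod_eq_of_lt h0 h1, Int.emod_eq_of_lt h0' h1'] at h2
  subst h2
  exact ⟨rfl, mul_left_cancel₀ (by omega) (add_left_cancel h)⟩

theorem intSite_inj {u : ℕ} {r r' : Fin u} {k k' : ℤ} (h : intSite r k = intSite r' k') :
    r = r' ∧ k = k' := by
  have := r.2
  have := r'.2
  obtain ⟨h1, h2⟩ := add_mul_inj (T := 2 * u) (by omega) (by omega) (by omega) (by omega) h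
  exact ⟨Fin.ext (by exact_mod_cast h1), h2⟩

theorem intSite_ne {u : ℕ} (r r' : Fin u) (k k' : ℤ) : intSite r k ≠ -1 - intSite r' k' := by
  intro h
  have := r.2
  have := r'.2
  have h' : ((r : ℕ) : ℤ) + 2 * u * k = (2 * u - 1 - (r' : ℕ)) + 2 * u * (-1 - k') := by
    rw [intSite, intSite] at h
    linear_combination h
  obtain ⟨h1, h2⟩ := add_mul_inj (T := 2 * u) (by omega) (by omega) (by omega) (by omega) h'
  omega

theorem exists_intSite {u : ℕ} (hu : 0 < u) (n : ℤ) :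
    ∃ (r : Fin u) (k : ℤ), n = intSite r k ∨ n = -1 - intSite r k := by
  have hT : (0 : ℤ) < 2 * u := by omega
  have h0 := Int.emod_nonneg n hT.ne'
  have h1 := Int.emod_lt_of_pos n hT
  have h2 := Int.emod_add_mul_ediv n (2 * u)
  generalize n / (2 * u) = k at h2
  by_cases h : n % (2 * u) < u
  · refine ⟨⟨(n % (2 * u)).toNat, by omega⟩, k, Or.inl ?_⟩
    rw [intSite]
    dsimp only
    rw [Int.toNat_of_nonneg h0, h2]
  · refine ⟨⟨(2 * u - 1 - n % (2 * u)).toNat, by omega⟩, -1 - k, Or.inr ?_⟩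
    rw [intSite]
    dsimp only
    rw [Int.toNat_of_nonneg (by omega)]
    linear_combination -h2

theorem loSite_inj {u : ℕ} {r r' : Fin u} {k k' : ℕ} (h : loSite r k = loSite r' k') :
    r = r' ∧ k = k' := by
  have := intSite_inj (r := r) (r' := r') (k := k) (k' := k')
    (by rw [intSite_natCast, intSite_natCast, h])
  exact ⟨this.1, by exact_mod_cast this.2⟩

theorem hiSite_inj {u : ℕ} {r r' : Fin u} {k k' : ℕ} (h : hiSite r k = hiSite r' k') :
    r = r' ∧ k = k' := by
  have := intSite_inj (r := r) (r' := r') (k := -1 - k) (k' := -1 - k')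
    (by rw [intSite_neg, intSite_neg, h])
  exact ⟨this.1, by omega⟩

theorem loSite_ne_hiSite {u : ℕ} (r r' : Fin u) (k k' : ℕ) : loSite r k ≠ hiSite r' k' := by
  intro h
  refine intSite_ne r r' k (-1 - k') ?_
  rw [intSite_natCast, intSite_neg, h]
  ring

theorem exists_site {u : ℕ} (hu : 0 < u) (n : ℕ) :
    ∃ (r : Fin u) (k : ℕ), n = loSite r k ∨ n = hiSite r k := by
  obtain ⟨r, k, h⟩ := exists_intSite hu n
  rcases int_cases k with ⟨k, rfl⟩ | ⟨k, rfl⟩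
  · rw [intSite_natCast] at h
    exact ⟨r, k, Or.inl (by omega)⟩
  · rw [intSite_neg] at h
    exact ⟨r, k, Or.inr (by omega)⟩

/-- The union of the sets with prescribed residue components. -/
def joinSites {u : ℕ} (p : Fin u → Finset ℕ × Finset ℕ) : Finset ℕ :=
  univ.biUnion fun r => (p r).1.image (loSite r) ∪ (p r).2.image (hiSite r)

theorem loSite_mem_joinSites {u : ℕ} {p : Fin u → Finset ℕ × Finset ℕ} {r : Fin u} {k : ℕ} :
    loSite r k ∈ joinSites p ↔ k ∈ (p r).1 := by
  simp only [joinSites, mem_biUnion, mem_univ, true_and, mem_union, mem_image]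
  constructor
  · rintro ⟨r', ⟨k', hk, h⟩ | ⟨k', hk, h⟩⟩
    · obtain ⟨rfl, rfl⟩ := loSite_inj h
      exact hk
    · exact absurd h.symm (loSite_ne_hiSite _ _ _ _)
  · exact fun h => ⟨r, Or.inl ⟨k, h, rfl⟩⟩

theorem hiSite_mem_joinSites {u : ℕ} {p : Fin u → Finset ℕ × Finset ℕ} {r : Fin u} {k : ℕ} :
    hiSite r k ∈ joinSites p ↔ k ∈ (p r).2 := by
  simp only [joinSites, mem_biUnion, mem_univ, true_and, mem_union, mem_image]
  constructor
  · rintro ⟨r', ⟨k', hk, h⟩ | ⟨k', hk, h⟩⟩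
    · exact absurd h (loSite_ne_hiSite _ _ _ _)
    · obtain ⟨rfl, rfl⟩ := hiSite_inj h
      exact hk
  · exact fun h => ⟨r, Or.inr ⟨k, h, rfl⟩⟩

/-- A finite set of natural numbers is determined by its residue components. -/
noncomputable def siteEquiv {u : ℕ} (hu : 0 < u) : (Fin u → Finset ℕ × Finset ℕ) ≃ Finset ℕ :=
  Equiv.ofBijective joinSites <| by
    constructor
    · intro p p' h
      funext r
      ext k
      · rw [← loSite_mem_joinSites, h, loSite_mem_joinSites]
      · rw [← hiSite_mem_joinSites, h, hiSite_mem_joinSites]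
    · intro A
      refine ⟨fun r => (A.preimage (loSite r) (Function.Injective.injOn fun _ _ h => (loSite_inj h).2),
        A.preimage (hiSite r) (Function.Injective.injOn fun _ _ h => (hiSite_inj h).2)), ?_⟩
      ext n
      obtain ⟨r, k, rfl | rfl⟩ := exists_site hu n
      · rw [loSite_mem_joinSites, mem_preimage]
      · rw [hiSite_mem_joinSites, mem_preimage]

theorem prod_joinSites {u : ℕ} (p : Fin u → Finset ℕ × Finset ℕ) (f : ℕ → ℂ) :
    ∏ a ∈ joinSites p, f a
      = ∏ r, ((∏ k ∈ (p r).1, f (loSite r k)) * ∏ k ∈ (p r).2, f (hiSite r k)) := by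
  rw [joinSites, prod_biUnion]
  · refine prod_congr rfl fun r _ => ?_
    rw [prod_union, prod_image fun _ _ _ _ h => (loSite_inj h).2,
      prod_image fun _ _ _ _ h => (hiSite_inj h).2]
    rw [disjoint_left]
    simp only [mem_image]
    rintro n ⟨k, _, rfl⟩ ⟨k', _, h⟩
    exact loSite_ne_hiSite _ _ _ _ h.symm
  · intro r _ r' _ hr
    rw [Function.onFun, disjoint_left]
    simp only [mem_union, mem_image]
    rintro n (⟨k, _, rfl⟩ | ⟨k, _, rfl⟩) (⟨k', _, h⟩ | ⟨k', _, h⟩)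
    · exact hr (loSite_inj h).1.symm
    · exact loSite_ne_hiSite _ _ _ _ h.symm
    · exact loSite_ne_hiSite _ _ _ _ h
    · exact hr (hiSite_inj h).1.symm

theorem intSite_mem_mayaSet {u : ℕ} {p : Fin u → Finset ℕ × Finset ℕ} {r : Fin u} {k : ℤ} :
    intSite r k ∈ mayaSet (joinSites p, joinSites p) ↔ k ∈ mayaSet (p r) := by
  rcases int_cases k with ⟨k, rfl⟩ | ⟨k, rfl⟩
  · rw [intSite_natCast, natCast_mem_mayaSet, natCast_mem_mayaSet, loSite_mem_joinSites]
  · rw [intSite_neg, neg_mem_mayaSet, neg_mem_mayaSet, hiSite_mem_joinSites]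

theorem neg_mem_mayaSet_diag {A : Finset ℕ} {n : ℤ} :
    -1 - n ∈ mayaSet (A, A) ↔ n ∉ mayaSet (A, A) := by
  rcases int_cases n with ⟨a, rfl⟩ | ⟨a, rfl⟩
  · rw [neg_mem_mayaSet, natCast_mem_mayaSet]
  · rw [neg_mem_mayaSet, show -1 - (-1 - (a : ℤ)) = a by ring, natCast_mem_mayaSet, not_not]

theorem intSite_sub {u : ℕ} (r : Fin u) (k k' : ℤ) :
    intSite r k - intSite r k' = 2 * u * (k - k') := by
  rw [intSite, intSite]; ring

/-- A pair at distance divisible by `2 * u` stays in one class. It comes from class `r` directly or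
from the opposite class by reflection, hence the square. -/
theorem finprod_invPairs_joinSites {u : ℕ} (hu : 0 < u) (p : Fin u → Finset ℕ × Finset ℕ)
    (w : ℕ → ℂ) :
    ∏ᶠ x ∈ invPairs (mayaSet (joinSites p, joinSites p)),
        (if 2 * u ∣ (x.1 - x.2).toNat then w (x.1 - x.2).toNat else 1)
      = ∏ r, ∏ᶠ x ∈ invPairs (mayaSet (p r)), w (2 * u * (x.1 - x.2).toNat) ^ 2 := by
  have hfin := fun r => finite_invPairs_mayaSet (p r)
  have hrhs : ∀ r, ∏ᶠ x ∈ invPairs (mayaSet (p r)), w (2 * u * (x.1 - x.2).toNat) ^ 2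
      = (∏ x ∈ (hfin r).toFinset, w (2 * u * (x.1 - x.2).toNat))
        * ∏ x ∈ (hfin r).toFinset, w (2 * u * (x.1 - x.2).toNat) := by
    intro r
    rw [finprod_mem_eq_finite_toFinset_prod _ (hfin r), ← prod_mul_distrib]
    exact prod_congr rfl fun x _ => sq _
  have hu' : (0 : ℤ) < 2 * u := by omega
  have hval : ∀ (r : Fin u) (x : ℤ × ℤ), x.2 < x.1 →
      (intSite r x.1 - intSite r x.2).toNat = 2 * u * (x.1 - x.2).toNat := by
    intro r x hx
    rw [intSite_sub]
    zify
    have : 0 < x.1 - x.2 := by omega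
    rw [Int.toNat_of_nonneg (by positivity), Int.toNat_of_nonneg this.le]
  have hlt : ∀ (r : Fin u) (k k' : ℤ), intSite r k' < intSite r k ↔ k' < k := by
    intro r k k'
    rw [← sub_pos, intSite_sub, mul_pos_iff_of_pos_left hu', sub_pos]
  rw [prod_congr rfl fun r _ => hrhs r, prod_mul_distrib,
    finprod_mem_eq_finite_toFinset_prod _ (finite_invPairs_mayaSet _), ← prod_filter,
    prod_sigma']
  symm
  refine (prod_disjSum _ _ (Sum.elim
    (fun z : (_ : Fin u) × (ℤ × ℤ) => w (2 * u * (z.2.1 - z.2.2).toNat))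
    (fun z : (_ : Fin u) × (ℤ × ℤ) => w (2 * u * (z.2.1 - z.2.2).toNat)))).symm.trans ?_
  -- The two summands are the two copies in the square. Reflection exchanges particles with holes,
  -- so the second copy also swaps the coordinates.
  refine prod_bij (fun y _ => Sum.elim
    (fun z : (_ : Fin u) × (ℤ × ℤ) => (intSite z.1 z.2.1, intSite z.1 z.2.2))
    (fun z : (_ : Fin u) × (ℤ × ℤ) => (-1 - intSite z.1 z.2.2, -1 - intSite z.1 z.2.1)) y)
    ?_ ?_ ?_ ?_
  · rintro (⟨r, x⟩ | ⟨r, x⟩) h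
    · simp only [inl_mem_disjSum, mem_sigma, Set.Finite.mem_toFinset] at h
      obtain ⟨-, h1, h2, h3⟩ := h
      simp only [Sum.elim_inl, mem_filter, Set.Finite.mem_toFinset]
      refine ⟨⟨intSite_mem_mayaSet.2 h1, mt intSite_mem_mayaSet.1 h2, (hlt _ _ _).2 h3⟩, ?_⟩
      rw [hval r x h3]
      exact dvd_mul_right _ _
    · simp only [inr_mem_disjSum, mem_sigma, Set.Finite.mem_toFinset] at h
      obtain ⟨-, h1, h2, h3⟩ := h
      simp only [Sum.elim_inr, mem_filter, Set.Finite.mem_toFinset]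
      refine ⟨⟨neg_mem_mayaSet_diag.2 (mt intSite_mem_mayaSet.1 h2),
        fun h => neg_mem_mayaSet_diag.1 h (intSite_mem_mayaSet.2 h1), ?_⟩, ?_⟩
      · have := (hlt r _ _).2 h3
        dsimp only
        omega
      · rw [show (-1 - intSite r x.2) - (-1 - intSite r x.1) = intSite r x.1 - intSite r x.2 by ring,
          hval r x h3]
        exact dvd_mul_right _ _
  · rintro (⟨r, x⟩ | ⟨r, x⟩) _ (⟨r', x'⟩ | ⟨r', x'⟩) _ h
    · simp only [Sum.elim_inl, Prod.mk.injEq] at h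
      obtain ⟨rfl, e1⟩ := intSite_inj h.1
      rw [Prod.ext e1 (intSite_inj h.2).2]
    · simp only [Sum.elim_inl, Sum.elim_inr, Prod.mk.injEq] at h
      exact absurd h.1 (intSite_ne _ _ _ _)
    · simp only [Sum.elim_inl, Sum.elim_inr, Prod.mk.injEq] at h
      exact absurd h.1.symm (intSite_ne _ _ _ _)
    · simp only [Sum.elim_inr, Prod.mk.injEq, sub_right_inj] at h
      obtain ⟨rfl, e1⟩ := intSite_inj h.1
      rw [Prod.ext (intSite_inj h.2).2 e1]
  · rintro ⟨m, n⟩ h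
    simp only [mem_filter, Set.Finite.mem_toFinset] at h
    obtain ⟨⟨h1, h2, h3⟩, h4⟩ := h
    dsimp only at h1 h2 h3
    have h4 : (2 * u : ℤ) ∣ m - n := by
      have := Int.natCast_dvd_natCast.2 h4
      rw [Int.toNat_of_nonneg (by omega)] at this
      exact_mod_cast this
    obtain ⟨d, hd⟩ := h4
    obtain ⟨r, k, rfl | rfl⟩ := exists_intSite hu m
    · have hn : n = intSite r (k - d) := by
        have := intSite_sub r k (k - d)
        rw [sub_sub_cancel] at this
        linarith
      subst hn
      refine ⟨Sum.inl ⟨r, (k, k - d)⟩, ?_, rfl⟩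
      simp only [inl_mem_disjSum, mem_sigma, mem_univ, Set.Finite.mem_toFinset, true_and]
      exact ⟨intSite_mem_mayaSet.1 h1, mt intSite_mem_mayaSet.2 h2, (hlt _ _ _).1 h3⟩
    · have hn : n = -1 - intSite r (k + d) := by
        have := intSite_sub r (k + d) k
        rw [add_sub_cancel_left] at this
        linarith
      subst hn
      refine ⟨Sum.inr ⟨r, (k + d, k)⟩, ?_, rfl⟩
      simp only [inr_mem_disjSum, mem_sigma, mem_univ, Set.Finite.mem_toFinset, true_and]
      rw [neg_mem_mayaSet_diag, intSite_mem_mayaSet] at h1 h2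
      exact ⟨not_not.1 h2, h1, (hlt r (k + d) k).1 (by linarith)⟩
  · rintro (⟨r, x⟩ | ⟨r, x⟩) h
    · simp only [inl_mem_disjSum, mem_sigma, Set.Finite.mem_toFinset] at h
      simp only [Sum.elim_inl]
      rw [hval r x h.2.2.2]
    · simp only [inr_mem_disjSum, mem_sigma, Set.Finite.mem_toFinset] at h
      simp only [Sum.elim_inr]
      rw [show (-1 - intSite r x.2) - (-1 - intSite r x.1) = intSite r x.1 - intSite r x.2 by ring,
          hval r x h.2.2.2]

end SelfConj

namespace SelfConj

open Finset

/-! ### Sums over all self-conjugate partitions -/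

theorem hasSum_prod_pi {β : Type*} (n : ℕ) (f : Fin n → β → ℂ)
    (hf : ∀ i, Summable fun b => ‖f i b‖) :
    (Summable fun p : Fin n → β => ‖∏ i, f i (p i)‖) ∧
      ∑' p : Fin n → β, ∏ i, f i (p i) = ∏ i, ∑' b, f i b := by
  induction n with
  | zero =>
    refine ⟨Summable.of_finite, ?_⟩
    rw [tsum_eq_single default fun b hb => absurd (Subsingleton.elim b _) hb]
    simp
  | succ n ih =>
    obtain ⟨h1, h2⟩ := ih (fun i => f i.succ) fun i => hf i.succ
    have key : ∀ x : β × (Fin n → β), ∏ i, f i (Fin.consEquiv (fun _ => β) x i)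
        = f 0 x.1 * ∏ i : Fin n, f i.succ (x.2 i) := by
      intro x
      rw [Fin.prod_univ_succ]
      rfl
    generalize hg : (fun p : Fin n → β => ∏ i : Fin n, f i.succ (p i)) = g at h1 h2
    have hg' : ∀ p : Fin n → β, ∏ i : Fin n, f i.succ (p i) = g p := fun p => congrFun hg p
    simp only [hg'] at key h1 h2
    constructor
    · rw [← (Fin.consEquiv fun _ => β).summable_iff]
      refine ((hf 0).mul_norm h1).congr fun x => ?_
      rw [← key]
      rfl
    · rw [Fin.prod_univ_succ, ← h2, tsum_mul_tsum_of_summable_norm (hf 0) h1,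
        ← (Fin.consEquiv fun _ => β).tsum_eq]
      exact tsum_congr key

/-- The weight of a diagonal hook with arm length `a`. -/
noncomputable def armWeight (q b : ℂ) (a : ℕ) : ℂ := q ^ (2 * a + 1) * b ^ ((-1 : ℤ) ^ a)

theorem prod_zpow_eq {b : ℂ} (hb : b ≠ 0) (s : Finset ℕ) (e : ℕ → ℤ) :
    ∏ a ∈ s, b ^ e a = b ^ ∑ a ∈ s, e a := by
  induction s using Finset.induction_on with
  | empty => simp
  | insert a s ha ih => rw [prod_insert ha, sum_insert ha, zpow_add₀ hb, ih]

theorem prod_armWeight {q b : ℂ} (hb : b ≠ 0) (s : Finset ℕ) (σ : ℕ → ℕ) :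
    ∏ a ∈ s, armWeight q b (σ a)
      = q ^ (∑ a ∈ s, (2 * σ a + 1)) * b ^ (∑ a ∈ s, (-1 : ℤ) ^ σ a) := by
  simp only [armWeight]
  rw [prod_mul_distrib, prod_pow_eq_pow_sum, prod_zpow_eq hb s fun a => (-1) ^ σ a]

theorem summable_armWeight {q b : ℂ} (hq : ‖q‖ < 1) : Summable fun a => ‖armWeight q b a‖ := by
  have h1 : Summable fun a : ℕ => ‖q‖ ^ a * (‖b‖ + ‖b⁻¹‖) :=
    (summable_geometric_of_lt_one (norm_nonneg q) hq).mul_right _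
  refine Summable.of_nonneg_of_le (fun _ => norm_nonneg _) (fun a => ?_) h1
  rw [armWeight, norm_mul, norm_pow]
  have h2 : ‖b ^ ((-1 : ℤ) ^ a)‖ ≤ ‖b‖ + ‖b⁻¹‖ := by
    rcases neg_one_pow_eq_or ℤ a with h | h <;> rw [h]
    · simp
    · simp
  exact mul_le_mul (pow_le_pow_of_le_one (norm_nonneg q) hq.le (by omega)) h2 (norm_nonneg _)
    (by positivity)

theorem summable_prod_norm {f : ℕ → ℂ} (hf : Summable fun a => ‖f a‖) :
    Summable fun A : Finset ℕ => ‖∏ a ∈ A, f a‖ := by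
  simpa only [norm_prod] using summable_finsetProd_of_summable_nonneg (fun _ => norm_nonneg _) hf

/-! ### Factorization over pairs of opposite residue classes -/

section Residue

variable {u : ℕ}

/-- The contribution of one pair of opposite residue classes. -/
noncomputable def pairWeight (q b : ℂ) (r : Fin u) (p : Finset ℕ × Finset ℕ) : ℂ :=
  (∏ k ∈ p.1, armWeight q b (loSite r k)) * ∏ k ∈ p.2, armWeight q b (hiSite r k)

/-- The contribution of the charge of one pair of opposite residue classes. -/
noncomputable def chargeWeight (q b : ℂ) (r : Fin u) (c : ℤ) : ℂ :=
  pairWeight q b r (mayaEquiv.symm (c, ⟨∅, notMem_empty _⟩))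

theorem neg_one_pow_loSite (r : Fin u) (k : ℕ) : (-1 : ℤ) ^ loSite r k = (-1) ^ (r : ℕ) := by
  rw [loSite, pow_add, mul_assoc, pow_mul, neg_one_sq, one_pow, mul_one]

theorem neg_one_pow_hiSite (r : Fin u) (k : ℕ) : (-1 : ℤ) ^ hiSite r k = -(-1) ^ (r : ℕ) := by
  have h := r.2
  rw [hiSite, pow_add, mul_assoc, pow_mul _ 2 (u * k), neg_one_sq, one_pow, mul_one,
    show -(-1 : ℤ) ^ (r : ℕ) = (-1) ^ ((r : ℕ) + 1) by rw [pow_succ]; ring]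
  refine neg_one_pow_congr ?_
  simp only [Nat.even_iff]
  omega

/-- The odd numbers `2 * site + 1` are `2u(2k + 1)` plus or minus the constant `2r + 1 - 2u`, so the
energy is combined linearly with the charge. -/
theorem energy_eq (r : Fin u) (p : Finset ℕ × Finset ℕ) :
    ((∑ k ∈ p.1, (2 * loSite r k + 1) + ∑ k ∈ p.2, (2 * hiSite r k + 1) : ℕ) : ℤ)
      = 4 * u * gapCount (mayaEquiv p).2.1
        + (2 * u * (mayaEquiv p).1 ^ 2 + (2 * (r : ℕ) + 1 - 2 * u) * (mayaEquiv p).1) := by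
  have h1 := mayaEquiv_energy p
  have h2 := mayaEquiv_fst p
  have e1 : ∀ k, ((2 * loSite r k + 1 : ℕ) : ℤ)
      = 2 * u * (2 * (k : ℤ) + 1) + (2 * (r : ℕ) + 1 - 2 * u) := by
    intro k
    rw [loSite]; push_cast; ring
  have e2 : ∀ k, ((2 * hiSite r k + 1 : ℕ) : ℤ) 
      = 2 * u * (2 * (k : ℤ) + 1) + (2 * u - 2 * (r : ℕ) - 1) := by
    intro k
    have := intSite_neg r k
    rw [intSite] at this
    push_cast
    linear_combination 2 * this
  rw [Nat.cast_add, Nat.cast_sum, Nat.cast_sum, sum_congr rfl fun k _ => e1 k,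
    sum_congr rfl fun k _ => e2 k, sum_add_distrib, sum_add_distrib, ← mul_sum, ← mul_sum,
    sum_const, sum_const, nsmul_eq_mul, nsmul_eq_mul]
  linear_combination (2 * u : ℤ) * h1 - (2 * (r : ℕ) + 1 - 2 * u : ℤ) * h2

theorem pairWeight_eq_pow {q b : ℂ} (hb : b ≠ 0) (r : Fin u) (p : Finset ℕ × Finset ℕ) :
    pairWeight q b r p
      = q ^ (∑ k ∈ p.1, (2 * loSite r k + 1) + ∑ k ∈ p.2, (2 * hiSite r k + 1))
        * b ^ ((-1) ^ (r : ℕ) * (mayaEquiv p).1) := by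
  rw [pairWeight, prod_armWeight hb, prod_armWeight hb, pow_add, mul_mul_mul_comm, ← zpow_add₀ hb]
  congr 2
  simp only [neg_one_pow_loSite, neg_one_pow_hiSite, sum_const, nsmul_eq_mul]
  rw [mayaEquiv_fst]
  ring

theorem pairWeight_eq {q b : ℂ} (hb : b ≠ 0) (r : Fin u) (p : Finset ℕ × Finset ℕ) :
    pairWeight q b r p
      = chargeWeight q b r (mayaEquiv p).1 * (q ^ (4 * u)) ^ gapCount (mayaEquiv p).2.1 := by
  rw [chargeWeight, pairWeight_eq_pow hb, pairWeight_eq_pow hb, mul_right_comm, ← pow_mul, ← pow_add,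
    Equiv.apply_symm_apply]
  congr 2
  have h1 := energy_eq r p
  have h2 := energy_eq r (mayaEquiv.symm ((mayaEquiv p).1, ⟨∅, notMem_empty _⟩))
  rw [Equiv.apply_symm_apply] at h2
  simp only [gapCount, sum_empty, Nat.cast_zero, mul_zero, zero_add] at h2
  rw [← h2] at h1
  zify at h1 ⊢
  rw [h1, gapCount]
  push_cast
  ring

theorem summable_pairWeight {q b : ℂ} (hq : ‖q‖ < 1) (r : Fin u) :
    Summable fun p => ‖pairWeight q b r p‖ := by
  have h1 : Summable fun k => ‖armWeight q b (loSite r k)‖ :=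
    (summable_armWeight hq).comp_injective fun _ _ h => (loSite_inj h).2
  have h2 : Summable fun k => ‖armWeight q b (hiSite r k)‖ :=
    (summable_armWeight hq).comp_injective fun _ _ h => (hiSite_inj h).2
  exact Summable.mul_norm (f := fun A : Finset ℕ => ∏ k ∈ A, armWeight q b (loSite r k))
    (g := fun B : Finset ℕ => ∏ k ∈ B, armWeight q b (hiSite r k))
    (summable_prod_norm h1) (summable_prod_norm h2)

theorem summable_chargeWeight {q b : ℂ} (hq : ‖q‖ < 1) (r : Fin u) :
    Summable fun c => ‖chargeWeight q b r c‖ :=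
  (summable_pairWeight hq r).comp_injective
    (i := fun c => mayaEquiv.symm (c, ⟨∅, notMem_empty _⟩)) fun c c' h => by
      simpa using mayaEquiv.symm.injective h

/-- These are the charge-zero terms of the convergent sum of `pairWeight` at `b = 1`, so no bound on
the number of partitions is needed. -/
theorem summable_pow_gapCount {q : ℂ} (hq : ‖q‖ < 1) (hu : 0 < u) :
    Summable fun L : BetaSet => ‖(q ^ (4 * u)) ^ gapCount L.1‖ := by
  have h := (summable_pairWeight (b := 1) hq (⟨0, hu⟩ : Fin u)).comp_injective
    (i := fun L => mayaEquiv.symm (0, L)) fun L L' h => by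
      simpa using mayaEquiv.symm.injective h
  refine h.congr fun L => ?_
  rw [Function.comp, pairWeight_eq one_ne_zero, Equiv.apply_symm_apply]
  have h0 : chargeWeight q 1 (⟨0, hu⟩ : Fin u) 0 = 1 := by
    have hz : mayaEquiv (∅, ∅) = (0, ⟨∅, notMem_empty _⟩) := by
      have h1 := mayaEquiv_fst (∅, ∅)
      have h2 := mayaEquiv_energy (∅, ∅)
      simp only [card_empty, Nat.cast_zero, sub_self] at h1
      simp only [h1, sum_empty] at h2
      have h3 : gapCount (mayaEquiv (∅, ∅)).2.1 = 0 := by omega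
      have h4 := mem_partSets.2 ⟨(mayaEquiv (∅, ∅)).2.2, h3⟩
      rw [partSets_zero, mem_singleton] at h4
      exact Prod.ext h1 (Subtype.ext h4)
    rw [chargeWeight, ← hz, Equiv.symm_apply_apply]
    simp [pairWeight]
  rw [h0, one_mul]

/-- The weight of a finite set of diagonal arm lengths, with hook-lengths divisible by `2 * u`
weighted by `w`. -/
noncomputable def armsWeight (q b : ℂ) (u : ℕ) (w : ℕ → ℂ) (A : Finset ℕ) : ℂ :=
  (∏ a ∈ A, armWeight q b a) * ∏ᶠ x ∈ invPairs (mayaSet (A, A)),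
    (if 2 * u ∣ (x.1 - x.2).toNat then w (x.1 - x.2).toNat else 1)

/-- Under `siteEquiv` the weight is a product over `r`, and under `mayaEquiv` each factor separates
charge from partition; absolute convergence permits both rearrangements. -/
theorem hasSum_armsWeight {q b : ℂ} (hq : ‖q‖ < 1) (hb : b ≠ 0) (hu : 0 < u) (w : ℕ → ℂ)
    (hw : Summable fun L : BetaSet =>
      ‖(q ^ (4 * u)) ^ gapCount L.1 * hookProd (fun h => w (2 * u * h) ^ 2) L.1‖) :
    HasSum (armsWeight q b u w)
      ((∏ r : Fin u, ∑' c, chargeWeight q b r c)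
        * (∑' L : BetaSet, (q ^ (4 * u)) ^ gapCount L.1
            * hookProd (fun h => w (2 * u * h) ^ 2) L.1) ^ u) := by
  set Ψ : Fin u → Finset ℕ × Finset ℕ → ℂ := fun r p => chargeWeight q b r (mayaEquiv p).1
    * ((q ^ (4 * u)) ^ gapCount (mayaEquiv p).2.1
      * hookProd (fun h => w (2 * u * h) ^ 2) (mayaEquiv p).2.1) with hΨ
  have hΨs : ∀ r, (Summable fun p => ‖Ψ r p‖) ∧ ∑' p, Ψ r p = (∑' c, chargeWeight q b r c)
      * ∑' L : BetaSet, (q ^ (4 * u)) ^ gapCount L.1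
            * hookProd (fun h => w (2 * u * h) ^ 2) L.1 := by
    intro r
    constructor
    · exact mayaEquiv.summable_iff.2 ((summable_chargeWeight hq r).mul_norm hw)
    · rw [tsum_mul_tsum_of_summable_norm (summable_chargeWeight hq r) hw, ← mayaEquiv.tsum_eq]
  have hfac : ∀ p : Fin u → Finset ℕ × Finset ℕ,
      armsWeight q b u w (siteEquiv hu p) = ∏ r, Ψ r (p r) := by
    intro p
    change armsWeight q b u w (joinSites p) = _
    rw [armsWeight, finprod_invPairs_joinSites hu, prod_joinSites, ← prod_mul_distrib]
    refine prod_congr rfl fun r _ => ?_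
    rw [finprod_invPairs_mayaSet fun h => w (2 * u * h) ^ 2, hΨ]
    dsimp only
    rw [← mul_assoc, ← pairWeight_eq hb, pairWeight]
  obtain ⟨h1, h2⟩ := hasSum_prod_pi u Ψ fun r => (hΨs r).1
  rw [← (siteEquiv hu).hasSum_iff, Function.comp_def]
  simp only [hfac]
  rw [prod_congr rfl fun r _ => (hΨs r).2, prod_mul_distrib, prod_const, card_univ,
    Fintype.card_fin] at h2
  rw [← h2]
  exact h1.of_norm.hasSum

/-- The case `w = 1` of `hasSum_armsWeight`: summing over all `A` expands the infinite product, and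
the partition sums cancel against `qPochhammerInf`. -/
theorem prod_tsum_chargeWeight {q b : ℂ} (hq : ‖q‖ < 1) (hb : b ≠ 0) (hu : 0 < u) :
    ∏ r : Fin u, ∑' c, chargeWeight q b r c
      = qPochhammerInf (q ^ (4 * u)) (q ^ (4 * u)) ^ u * ∏' a, (1 + armWeight q b a) := by
  have hone : ∀ L, hookProd (fun _ : ℕ => (1 : ℂ) ^ 2) L = 1 := fun L => by simp [hookProd]
  have hs := summable_pow_gapCount hq hu
  have h := hasSum_armsWeight hq hb hu (fun _ => 1) (by simpa only [hone, mul_one] using hs)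
  simp only [hone, mul_one] at h
  have hA : armsWeight q b u (fun _ => 1) = fun A => ∏ a ∈ A, armWeight q b a := by
    funext A
    simp [armsWeight]
  rw [hA] at h
  have hQ : ‖q ^ (4 * u)‖ < 1 := by
    rw [norm_pow]
    exact pow_lt_one₀ (norm_nonneg q) hq (by omega)
  rw [tprod_one_add h.summable, h.tsum_eq, mul_left_comm, ← mul_pow, tsum_pow_gapCount hQ hs,
    one_pow, mul_one]

end Residue

/-! ### Assembly of the formula -/

theorem hookProd_mul_inv (z : ℂ) (L : Finset ℕ) :
    hookProd (fun h : ℕ => z * (h : ℂ)⁻¹) L = z ^ gapCount L * hookWeight L := by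
  rw [gapCount, hookWeight, hookProd, hookProd, ← prod_pow_eq_pow_sum]
  push_cast
  rw [← prod_mul_distrib]
  refine prod_congr rfl fun l _ => ?_
  rw [prod_mul_distrib, prod_const]

theorem tprod_armWeight {q b : ℂ} (hq : ‖q‖ < 1) :
    ∏' a, (1 + armWeight q b a)
      = qPochhammerInf (-(b * q)) (q ^ 4) * qPochhammerInf (-(q ^ 3 / b)) (q ^ 4) := by
  have hq4 : ‖q ^ 4‖ < 1 := by
    rw [norm_pow]
    exact pow_lt_one₀ (norm_nonneg q) hq (by omega)
  have he : ∀ k, 1 + armWeight q b (2 * k) = 1 - -(b * q) * (q ^ 4) ^ k := by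
    intro k
    rw [armWeight, pow_mul (-1 : ℤ), neg_one_sq, one_pow, zpow_one]
    ring
  have ho : ∀ k, 1 + armWeight q b (2 * k + 1) = 1 - -(q ^ 3 / b) * (q ^ 4) ^ k := by
    intro k
    rw [armWeight, pow_succ (-1 : ℤ), pow_mul (-1 : ℤ), neg_one_sq, one_pow, one_mul, zpow_neg_one]
    ring
  have h := tprod_even_mul_odd (f := fun a => 1 + armWeight q b a)
    (by simpa only [he] using multipliable_qPochhammerInf _ hq4)
    (by simpa only [ho] using multipliable_qPochhammerInf _ hq4)
  rw [← h, qPochhammerInf, qPochhammerInf]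
  simp only [he, ho]

theorem term_eq_armsWeight {q b : ℂ} (hb : b ≠ 0) (u : ℕ) (x : ℂ)
    (μ : {μ : YoungDiagram // IsSelfConjugate μ}) :
    q ^ μ.1.card * x ^ (hooksMod (2 * u) μ.1).card * b ^ bgRank μ.1
        * ((hooksMod (2 * u) μ.1).map fun h : ℕ => 1 / ((√(h : ℝ) : ℝ) : ℂ)).prod
      = armsWeight q b u (fun h => x / ((√(h : ℝ) : ℝ) : ℂ)) (armsEquiv μ) := by
  have h1 : x ^ (hooksMod (2 * u) μ.1).card
      * ((hooksMod (2 * u) μ.1).map fun h : ℕ => 1 / ((√(h : ℝ) : ℝ) : ℂ)).prod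
      = ((hooksMod (2 * u) μ.1).map fun h : ℕ => x / ((√(h : ℝ) : ℝ) : ℂ)).prod := by
    simp only [div_eq_mul_inv x, one_div]
    rw [Multiset.prod_map_mul, Multiset.map_const', Multiset.prod_replicate]
  have h2 : ((hooksMod (2 * u) μ.1).map fun h : ℕ => x / ((√(h : ℝ) : ℝ) : ℂ)).prod
      = ∏ c ∈ μ.1.cells, if 2 * u ∣ hookLength μ.1 c
          then x / ((√(hookLength μ.1 c : ℝ) : ℝ) : ℂ) else 1 := by
    rw [hooksMod, hooks, Multiset.filter_map, Multiset.map_map, ← prod_filter]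
    rfl
  rw [armsWeight]
  change _ = (∏ a ∈ diagArms μ.1, _) * ∏ᶠ x ∈ invPairs (mayaSet (diagArms μ.1, diagArms μ.1)), _
  rw [← prod_hookLength μ.2 fun h => if 2 * u ∣ h then x / ((√(h : ℝ) : ℝ) : ℂ) else 1, ← h2, ← h1,
    prod_armWeight hb _ fun a => a, card_eq_sum_diagArms μ.2, bgRank_eq_sum_diagArms μ.2]
  ring

end SelfConj

theorem corollary4p2 (t : ℕ) (ht : 0 < t) (hteven : Even t)
    (q x b : ℂ) (hq : ‖q‖ < 1) (hb : b ≠ 0) :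
    HasSum
      (fun μ : {μ : YoungDiagram // SelfConj.IsSelfConjugate μ} =>
        q ^ μ.1.card
          * x ^ (SelfConj.hooksMod t μ.1).card
          * b ^ SelfConj.bgRank μ.1
          * ((SelfConj.hooksMod t μ.1).map fun h : ℕ => 1 / ((√(h : ℝ) : ℝ) : ℂ)).prod)
      (SelfConj.qPochhammerInf (q ^ (2 * t)) (q ^ (2 * t)) ^ (t / 2)
        * SelfConj.qPochhammerInf (-(b * q)) (q ^ 4)
        * SelfConj.qPochhammerInf (-(q ^ 3 / b)) (q ^ 4)
        * Complex.exp (x ^ 2 * q ^ (2 * t) / 2 + x ^ 4 * q ^ (4 * t) / (4 * (t : ℂ)))) := by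
  obtain ⟨u, rfl⟩ := hteven.two_dvd
  have hu : 0 < u := by omega
  have huc : (u : ℂ) ≠ 0 := by exact_mod_cast hu.ne'
  -- Each box of a component partition carries `q ^ (4 * u)` from the energy and `x ^ 2 / (2 * u)`
  -- from its two hooks of length `2 * u * h`.
  set y : ℂ := q ^ (4 * u) * (x ^ 2 / (2 * u)) with hy
  have hg : ∀ h : ℕ, (x / ((√((2 * u * h : ℕ) : ℝ) : ℝ) : ℂ)) ^ 2 = x ^ 2 / (2 * u) * (h : ℂ)⁻¹ := by
    intro h
    rw [div_pow, ← Complex.ofReal_pow, Real.sq_sqrt (Nat.cast_nonneg _)]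
    push_cast
    rw [div_mul_eq_div_div, div_eq_mul_inv _ (h : ℂ)]
  have hterm : ∀ L : SelfConj.BetaSet, (q ^ (4 * u)) ^ SelfConj.gapCount L.1
      * SelfConj.hookProd (fun h => (x / ((√((2 * u * h : ℕ) : ℝ) : ℝ) : ℂ)) ^ 2) L.1
      = (SelfConj.hookWeight L.1 : ℂ) * y ^ SelfConj.gapCount L.1 := by
    intro L
    simp only [hg]
    rw [SelfConj.hookProd_mul_inv, hy, mul_pow (q ^ (4 * u))]
    ring
  have h := SelfConj.hasSum_armsWeight hq hb hu (fun h => x / ((√(h : ℝ) : ℝ) : ℂ))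
    (by simpa only [hterm] using SelfConj.summable_hookWeight y)
  simp only [hterm] at h
  rw [SelfConj.tsum_hookWeight, SelfConj.prod_tsum_chargeWeight hq hb hu,
    SelfConj.tprod_armWeight hq, ← Complex.exp_nat_mul] at h
  rw [← SelfConj.armsEquiv.hasSum_iff] at h
  convert h using 1
  · funext μ
    exact SelfConj.term_eq_armsWeight hb u x μ
  · rw [show 2 * (2 * u) = 4 * u by ring, show 4 * (2 * u) = 4 * u * 2 by ring,
      Nat.mul_div_cancel_left u two_pos, ← mul_assoc, hy]
    congr 2
    push_cast
    rw [pow_mul q (4 * u) 2]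
    field_simp
    ring
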